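/- Let $\mathbb T^d=(\mathbb R/2\pi\mathbb Z)^d$, $d\ge 1$, with the normalized measure (total mass one), used in all integrals. For real $s\ge 0$ let $H^s_0(\mathbb T^d,\mathbb R)$ be the space of real-valued zero-mean functions $u=\sum_{j\in\mathbb Z^d\setminus\{0\}}u_j e^{ij\cdot x}$ with $\|u\|_s^2:=\sum_{j\neq 0}|u_j|^2|j|^{2s}<\infty$. Let $m_0=1$ if $d=1$ and $m_0=\frac32$ if $d\ge 2$. Consider the Cauchy problem $$\partial_{tt}u-\Big(1+\int_{\mathbb T^d}|\nabla u|^2\,dx\Big)\Delta u=0,\qquad u(0,x)=\alpha(x),\quad \partial_t u(0,x)=\beta(x),\tag{K}$$ where, at each time, the equation is understood in the sense of distributions on $\mathbb T^d$. There exist universal constants $\varepsilon_0,C,C_1>0$ (independent of $d$, of the data and of $s$ below) with the following properties. Let $(\alpha,\beta)\in H_0^{m_0+1/2}(\mathbb T^d,\mathbb R)\times H_0^{m_0-1/2}(\mathbb T^d,\mathbb R)$ with $$\varepsilon:=\|\alpha\|_{m_0+\frac12}+\|\beta\|_{m_0-\frac12}\le\varepsilon_0,$$ and let $T>0$ satisfy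 $T\varepsilon^4\le C_1$ (so $T=C_1\varepsilon^{-4}$ is allowed if $\varepsilon>0$, and every $T>0$ is allowed if $\varepsilon=0$). Then (K) has a unique solution $$u\in C^0([0,T],H_0^{m_0+\frac12}(\mathbb T^d,\mathbb R))\cap C^1([0,T],H_0^{m_0-\frac12}(\mathbb T^d,\mathbb R))$$ on $[0,T]$, and $$\max_{t\in[0,T]}\big(\|u(t)\|_{m_0+\frac12}+\|\partial_t u(t)\|_{m_0-\frac12}\big)\le C\varepsilon.$$ If, in addition, $(\alpha,\beta)\in H_0^{s+1/2}(\mathbb T^d,\mathbb R)\times H_0^{s-1/2}(\mathbb T^d,\mathbb R)$ for some real $s\ge m_0$, then $u\in C^0([0,T],H_0^{s+\frac12}(\mathbb T^d,\mathbb R))\cap C^1([0,T],H_0^{s-\frac12}(\mathbb T^d,\mathbb R))$ and $$\max_{t\in[0,T]}\big(\|u(t)\|_{s+\frac12}+\|\partial_t u(t)\|_{s-\frac12}\big)\le C\big(\|\alpha\|_{s+\frac12}+\|\beta\|_{s-\frac12}\big).$$ -/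

import Mathlib

open MeasureTheory Filter Topology

noncomputable section

namespace Kirchhoff

/-- The normalized measure (total mass one) on the torus `𝕋^d = (ℝ/2πℤ)^d`, which is parametrized
by the unit torus through `x = 2πy`. Thus Mathlib's character `UnitAddTorus.mFourier j`,
`y ↦ exp(2πi j·y)`, is the function `x ↦ exp(i j·x)`.
All derivatives below are derivatives with respect to `x`. -/
abbrev torusMeasure (d : ℕ) : Measure (UnitAddTorus (Fin d)) :=
  Measure.pi fun _ => AddCircle.haarAddCircle

/-- The space `L²(𝕋^d, ℂ)`. -/
abbrev L2Torus (d : ℕ) : Type := Lp ℂ 2 (torusMeasure d)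

/-- The Fourier coefficient `u_j = ∫_{𝕋^d} u(x) exp(-i j·x) dx` (normalized measure). -/
def coeff {d : ℕ} (u : L2Torus d) (j : Fin d → ℤ) : ℂ :=
  ∫ x, UnitAddTorus.mFourier (-j) x * u x ∂(torusMeasure d)

/-- The Euclidean length `|j|` of a frequency `j ∈ ℤ^d`. -/
def freqNorm {d : ℕ} (j : Fin d → ℤ) : ℝ := Real.sqrt (∑ i, (j i : ℝ) ^ 2)

/-- The Sobolev norm `‖u‖_s = (∑_{j ≠ 0} |u_j|² |j|^{2s})^{1/2}`
(meaningful when the series converges, see `MemHs`). -/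
def sobNorm {d : ℕ} (s : ℝ) (u : L2Torus d) : ℝ :=
  Real.sqrt (∑' j : {j : Fin d → ℤ // j ≠ 0}, ‖coeff u j.1‖ ^ 2 * freqNorm j.1 ^ (2 * s))

/-- `u ∈ H^s_0(𝕋^d, ℝ)` (for `s ≥ 0`): `u` is real-valued, has zero mean, and `‖u‖_s < ∞`. -/
structure MemHs {d : ℕ} (s : ℝ) (u : L2Torus d) : Prop where
  real_valued : ∀ᵐ x ∂(torusMeasure d), (u x).im = 0
  zero_mean : coeff u 0 = 0
  finite_norm : Summable fun j : {j : Fin d → ℤ // j ≠ 0} =>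
    ‖coeff u j.1‖ ^ 2 * freqNorm j.1 ^ (2 * s)

/-- `u ∈ C⁰([0,T], H^s_0(𝕋^d, ℝ))`. -/
structure IsC0 {d : ℕ} (T s : ℝ) (u : ℝ → L2Torus d) : Prop where
  mem : ∀ t ∈ Set.Icc 0 T, MemHs s (u t)
  continuous : ∀ t ∈ Set.Icc 0 T,
    Tendsto (fun τ => sobNorm s (u τ - u t)) (𝓝[Set.Icc 0 T] t) (𝓝 0)

/-- `u ∈ C¹([0,T], H^s_0(𝕋^d, ℝ))` with `∂_t u = v`: both are continuous in `H^s_0`, and the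
difference quotients of `u` converge to `v` in the norm of `H^s_0` (one-sided at `0` and `T`). -/
structure IsC1 {d : ℕ} (T s : ℝ) (u v : ℝ → L2Torus d) : Prop where
  continuous : IsC0 T s u
  deriv_continuous : IsC0 T s v
  hasDeriv : ∀ t ∈ Set.Icc 0 T,
    Tendsto (fun τ => sobNorm s ((τ - t)⁻¹ • (u τ - u t) - v t))
      (𝓝[Set.Icc 0 T \ {t}] t) (𝓝 0)

/-- `g = (g_1, …, g_d)`, with `g_i ∈ L²(𝕋^d)`, is the gradient `∇u` in the sense of periodic
distributions: tested against every `exp(-i j·x)`, `g_i` agrees with `∂_i u`. -/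
def IsGradient {d : ℕ} (u : L2Torus d) (g : Fin d → L2Torus d) : Prop :=
  ∀ (i : Fin d) (j : Fin d → ℤ), coeff (g i) j = Complex.I * (j i : ℂ) * coeff u j

/-- The number `∫_{𝕋^d} |g|² dx` for a vector field `g` on the torus (normalized measure). -/
def integralSq {d : ℕ} (g : Fin d → L2Torus d) : ℝ := ∫ x, ∑ i, ‖g i x‖ ^ 2 ∂(torusMeasure d)

/-- The Fourier coefficients of the periodic distribution `Δu`. -/
def laplacianCoeff {d : ℕ} (u : L2Torus d) (j : Fin d → ℤ) : ℂ :=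
  -((freqNorm j ^ 2 : ℝ) : ℂ) * coeff u j

/-- On `[0,T]`, `u` with `v = ∂_t u` is a solution in
`C⁰([0,T], H^{m+1/2}_0(𝕋^d, ℝ)) ∩ C¹([0,T], H^{m-1/2}_0(𝕋^d, ℝ))` of the Cauchy problem
`∂_tt u - (1 + ∫ |∇u|²) Δu = 0`, `u(0) = α`, `∂_t u(0) = β`.
At each time the equation is an identity of periodic distributions, that is, it holds when
tested against every `exp(-i j·x)`. -/
structure IsSolution {d : ℕ} (T m : ℝ) (α β : L2Torus d) (u v : ℝ → L2Torus d) : Prop where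
  regular : IsC0 T (m + 1 / 2) u
  regular_deriv : IsC1 T (m - 1 / 2) u v
  initial : u 0 = α
  initial_deriv : v 0 = β
  equation : ∀ t ∈ Set.Icc 0 T, ∃ g : Fin d → L2Torus d, IsGradient (u t) g ∧
    ∀ j : Fin d → ℤ, HasDerivWithinAt (fun τ => coeff (v τ) j)
      (((1 + integralSq g : ℝ) : ℂ) * laplacianCoeff (u t) j) (Set.Icc 0 T) t

/-- The regularity threshold `m₀`: `1` in dimension one, `3/2` in dimension at least two. -/
def m₀ (d : ℕ) : ℝ := if d = 1 then 1 else 3 / 2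

end Kirchhoff

end

namespace Kirchhoff

open Set

/-! ## Differential inequalities on a compact interval -/

/-! In Fourier series the equation is a family of oscillators `u_j'' + a(t) |j|² u_j = 0`, coupled
only through `a = 1 + ∑ |j|² |u_j|²`. With `b = √a`, `B = b'/b`, `λ = |j|`, each mode has the
quantities `E = bλ|u|² + |v|²/(bλ)`, `D = bλ|u|² - |v|²/(bλ)` and `F = 2⟨u,v⟩`, which satisfy `E' =
B D`, `D' = 2bλF + B E`, `F' = -2bλD` and `2b²B = ∑ λ² F`. So the energy changes only through
products `F_j D_k`, quartic in the solution.

These products oscillate and can be integrated by parts in time: `D_j D_k - F_j F_k` and `D_j D_k +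
F_j F_k` have derivatives with factors `λ_j + λ_k` and `λ_j - λ_k`, up to higher order. The resonant
terms `λ_j = λ_k` cancel once the energies are summed over a whole sphere of frequencies
(`hasDerivWithinAt_correction`). Subtracting the correction leaves a growth rate `O(δ²)`, where `δ ~
ε²` bounds the energy at the threshold regularity; this gives the time `ε⁻⁴` (`sphere_energy_le`).
Division by `λ_j - λ_k` costs nothing when `d = 1`, where the lengths are integers, and a factor
`3λ_j` when `d ≥ 2`, where their squares are integers (`inv_abs_freqNorm_sub_le`); this explains
`m₀`.

Since the estimate holds on each sphere separately, every energy weighted by a function of `|j|`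
grows by at most a constant factor, hence the same constant for all `s`; a continuity argument
removes the smallness assumption (`weighted_energy_le`). Solutions with finitely many modes are
global. A Gronwall estimate in `H^{1/2} × H^{-1/2}` (`ModeSystem.stability`) makes them converge and
also compares them with any other solution, which gives uniqueness (`exists_modeSystem`). Bounds
mode by mode then yield continuity in every `H^s` by dominated convergence (`regularity_of_modes`),
and `exists_isSolution` transfers the result to the torus. -/

theorem antitoneOn_Icc_of_hasDerivWithinAt {T : ℝ} {f f' : ℝ → ℝ}
    (hf : ∀ t ∈ Icc 0 T, HasDerivWithinAt f (f' t) (Icc 0 T) t)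
    (hf' : ∀ t ∈ Icc 0 T, f' t ≤ 0) : AntitoneOn f (Icc 0 T) :=
  antitoneOn_of_hasDerivWithinAt_nonpos (convex_Icc 0 T)
    (fun t ht => (hf t ht).continuousWithinAt)
    (fun t ht => (hf t (interior_subset ht)).mono interior_subset)
    (fun t ht => hf' t (interior_subset ht))

theorem le_exp_mul_of_deriv_le {T K : ℝ} {f f' : ℝ → ℝ}
    (hf : ∀ t ∈ Icc 0 T, HasDerivWithinAt f (f' t) (Icc 0 T) t)
    (hf' : ∀ t ∈ Icc 0 T, f' t ≤ K * f t) {t : ℝ} (ht : t ∈ Icc 0 T) :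
    f t ≤ Real.exp (K * t) * f 0 := by
  have hexp : ∀ s, HasDerivAt (fun s : ℝ => Real.exp (-(K * s))) (Real.exp (-(K * s)) * -K) s :=
    fun s => by simpa using (((hasDerivAt_id s).const_mul K).neg).exp
  have h := antitoneOn_Icc_of_hasDerivWithinAt
    (fun s hs => ((hexp s).hasDerivWithinAt.mul (hf s hs)))
    (fun s hs => by
      have := mul_le_mul_of_nonneg_left (hf' s hs) (Real.exp_pos (-(K * s))).le
      nlinarith) ⟨le_rfl, ht.1.trans ht.2⟩ ht ht.1
  simp only [Pi.mul_apply, mul_zero, neg_zero, Real.exp_zero, one_mul] at h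
  have h2 := mul_le_mul_of_nonneg_left h (Real.exp_pos (K * t)).le
  rwa [← mul_assoc, ← Real.exp_add, add_neg_cancel, Real.exp_zero, one_mul] at h2

/-- Gronwall's inequality with a nonnegative forcing term `R * y'`. -/
theorem le_exp_mul_add_of_deriv_le {T K R : ℝ} (hK : 0 ≤ K) (hR : 0 ≤ R) {f f' y y' : ℝ → ℝ}
    (hf : ∀ t ∈ Icc 0 T, HasDerivWithinAt f (f' t) (Icc 0 T) t)
    (hy : ∀ t ∈ Icc 0 T, HasDerivWithinAt y (y' t) (Icc 0 T) t)
    (hy0 : y 0 = 0) (hy' : ∀ t ∈ Icc 0 T, 0 ≤ y' t)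
    (hf' : ∀ t ∈ Icc 0 T, f' t ≤ K * f t + R * y' t) {t : ℝ} (ht : t ∈ Icc 0 T) :
    f t ≤ Real.exp (K * t) * (f 0 + R * y t) := by
  have hexp : ∀ s, HasDerivAt (fun s : ℝ => Real.exp (-(K * s))) (Real.exp (-(K * s)) * -K) s :=
    fun s => by simpa using (((hasDerivAt_id s).const_mul K).neg).exp
  have h := antitoneOn_Icc_of_hasDerivWithinAt
    (fun s hs => (((hexp s).hasDerivWithinAt.mul (hf s hs)).sub ((hy s hs).const_mul R)))
    (fun s hs => by
      have h1 := mul_le_mul_of_nonneg_left (hf' s hs) (Real.exp_pos (-(K * s))).le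
      -- The integrating factor is at most one for `s ≥ 0`, so the forcing term may be kept without
      -- it.
      have h2 : Real.exp (-(K * s)) ≤ 1 := Real.exp_le_one_iff.2 (by nlinarith [hs.1])
      have h3 := mul_le_mul_of_nonneg_right h2 (mul_nonneg hR (hy' s hs))
      nlinarith) ⟨le_rfl, ht.1.trans ht.2⟩ ht ht.1
  simp only [Pi.mul_apply, Pi.sub_apply, mul_zero, neg_zero, Real.exp_zero, one_mul, hy0,
    sub_zero] at h
  have h2 := mul_le_mul_of_nonneg_left (sub_le_iff_le_add.1 h) (Real.exp_pos (K * t)).le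
  rwa [← mul_assoc, ← Real.exp_add, add_neg_cancel, Real.exp_zero, one_mul] at h2

/-- A continuity argument. -/
theorem lt_of_bootstrap {T δ : ℝ} {M : ℝ → ℝ} (hM : ContinuousOn M (Icc 0 T)) (h0 : M 0 < δ)
    (hstep : ∀ t ∈ Icc 0 T, (∀ s ∈ Icc 0 t, M s ≤ δ) → M t < δ) : ∀ t ∈ Icc 0 T, M t < δ := by
  intro t ht
  by_contra! hlt
  have hcl : IsCompact (Icc 0 T ∩ M ⁻¹' Ici δ) :=
    isCompact_Icc.of_isClosed_subset (hM.preimage_isClosed_of_isClosed isClosed_Icc isClosed_Ici)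
      inter_subset_left
  -- `t₀` is the first time at which `M ≥ δ`; by the intermediate value theorem `M t₀ = δ`, which
  -- contradicts the strict improvement.
  obtain ⟨t₀, ⟨ht₀, hδ⟩, hleast⟩ := hcl.exists_isLeast ⟨t, ht, hlt⟩
  obtain ⟨c, hc, hcδ⟩ := intermediate_value_Icc ht₀.1
    (hM.mono (Icc_subset_Icc le_rfl ht₀.2)) ⟨h0.le, hδ⟩
  have hc' : t₀ ≤ c := hleast ⟨⟨hc.1, hc.2.trans ht₀.2⟩, hcδ.ge⟩
  have hMt₀ : M t₀ = δ := by rw [← le_antisymm hc.2 hc', hcδ]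
  refine (hstep t₀ ht₀ fun s hs => ?_).ne hMt₀
  by_contra! hs'
  have := hleast ⟨⟨hs.1, hs.2.trans ht₀.2⟩, hs'.le⟩
  rw [le_antisymm hs.2 this, hMt₀] at hs'
  exact lt_irrefl _ hs'

/-- Passing to the limit in derivatives, at every point of a compact interval. -/
theorem hasDerivWithinAt_of_tendstoUniformlyOn_Icc {α : Type*} {l : Filter α} [l.NeBot] {T : ℝ}
    {F G : α → ℝ → ℂ} {f g : ℝ → ℂ}
    (hF : ∀ n, ∀ t ∈ Icc 0 T, HasDerivWithinAt (F n) (G n t) (Icc 0 T) t)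
    (hf : ∀ t ∈ Icc 0 T, Tendsto (fun n => F n t) l (𝓝 (f t)))
    (hG : TendstoUniformlyOn G g l (Icc 0 T)) (hg : ContinuousOn g (Icc 0 T)) {t : ℝ}
    (ht : t ∈ Icc 0 T) : HasDerivWithinAt f (g t) (Icc 0 T) t := by
  rw [hasDerivWithinAt_iff_isLittleO, Asymptotics.isLittleO_iff]
  intro c hc
  have hc2 : 0 < c / 2 := half_pos hc
  have hcont := Metric.continuousWithinAt_iff.1 (hg t ht) (c / 2) hc2
  obtain ⟨r, hr, hball⟩ := hcont
  have hmem : Icc 0 T ∩ Metric.ball t r ∈ 𝓝[Icc 0 T] t :=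
    inter_mem self_mem_nhdsWithin (mem_nhdsWithin_of_mem_nhds (Metric.ball_mem_nhds t hr))
  filter_upwards [hmem] with τ hτ
  have hev := Metric.tendstoUniformlyOn_iff.1 hG (c / 2) hc2
  have hlim : Tendsto (fun n => ‖F n τ - F n t - (τ - t) • g t‖) l
      (𝓝 ‖f τ - f t - (τ - t) • g t‖) :=
    (((hf τ hτ.1).sub (hf t ht)).sub tendsto_const_nhds).norm
  refine le_of_tendsto hlim ?_
  filter_upwards [hev] with n hn
  have hconv : Convex ℝ (Icc 0 T ∩ Metric.ball t r) :=
    (convex_Icc 0 T).inter (convex_ball t r)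
  -- The mean value inequality for `F n s - s • g t`, whose derivative is small near `t` uniformly
  -- in `n`, also works at the endpoints, since the intersection of the interval with a ball is
  -- convex.
  have hder : ∀ s ∈ Icc 0 T ∩ Metric.ball t r,
      HasDerivWithinAt (fun s => F n s - s • g t) (G n s - (1 : ℝ) • g t)
        (Icc 0 T ∩ Metric.ball t r) s := fun s hs =>
    ((hF n s hs.1).mono inter_subset_left).sub ((hasDerivWithinAt_id s _).smul_const (g t))
  have hb : ∀ s ∈ Icc 0 T ∩ Metric.ball t r, ‖G n s - (1 : ℝ) • g t‖ ≤ c := fun s hs => by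
    have h1 := hn s hs.1
    have h2 := hball hs.1 hs.2
    rw [dist_comm, dist_eq_norm] at h1
    rw [dist_eq_norm] at h2
    calc ‖G n s - (1 : ℝ) • g t‖ = ‖(G n s - g s) + (g s - g t)‖ := by simp
      _ ≤ c := (norm_add_le _ _).trans (by linarith)
  have := hconv.norm_image_sub_le_of_norm_hasDerivWithin_le hder hb
    ⟨ht, Metric.mem_ball_self hr⟩ hτ
  have heq : F n τ - F n t - (τ - t) • g t = F n τ - τ • g t - (F n t - t • g t) := by
    rw [sub_smul]; ring
  rwa [heq]

/-- A continuous function on `[0,T]` has an antiderivative there. -/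
theorem exists_antideriv_Icc {T : ℝ} (hT : 0 ≤ T) {g : ℝ → ℝ} (hg : ContinuousOn g (Icc 0 T)) :
    ∃ y : ℝ → ℝ, y 0 = 0 ∧ ∀ t ∈ Icc 0 T, HasDerivWithinAt y (g t) (Icc 0 T) t := by
  have hc : Continuous (IccExtend hT ((Icc 0 T).domRestrict g)) :=
    (continuousOn_iff_continuous_domRestrict.1 hg).Icc_extend'
  refine ⟨fun t => ∫ s in (0 : ℝ)..t, IccExtend hT ((Icc 0 T).domRestrict g) s, by simp,
    fun t ht => ?_⟩
  have := (intervalIntegral.integral_hasDerivAt_right (hc.intervalIntegrable 0 t)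
    (hc.stronglyMeasurableAtFilter _ _) hc.continuousAt).hasDerivWithinAt (s := Icc 0 T)
  rwa [IccExtend_of_mem hT _ ht] at this

/-! ## Normal form of the energies on spheres of frequencies -/

section NormalForm

variable {ι : Type*} {S : Finset ι} {lam rho : ι → ℝ} {μ T δ : ℝ} {b B : ℝ → ℝ}
  {E D F : ℝ → ι → ℝ}

/-- The quartic correction of the energy on the sphere of radius `μ`. -/
noncomputable def correction (S : Finset ι) (lam : ι → ℝ) (μ : ℝ) (D F : ι → ℝ) (Dm Fm : ℝ) : ℝ :=
  ∑ j ∈ S, (lam j ^ 2 / (lam j + μ) * (D j * Dm - F j * Fm) +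
    lam j ^ 2 / (lam j - μ) * (D j * Dm + F j * Fm))

/-- The remainder in the time derivative of `correction`. -/
noncomputable def correctionRem (S : Finset ι) (lam : ι → ℝ) (μ : ℝ) (E D : ι → ℝ)
    (Em Dm : ℝ) : ℝ :=
  ∑ j ∈ S, (lam j ^ 2 / (lam j + μ) + lam j ^ 2 / (lam j - μ)) * (E j * Dm + D j * Em)

/-- When `B = 0`, the combination `D_j D_m - F_j F_m` has derivative `2b(λ+μ)(F_j D_m + D_j F_m)`
and `D_j D_m + F_j F_m` has derivative `2b(λ-μ)(F_j D_m - D_j F_m)`. Dividing by the two factors and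
adding leaves `4b F_j D_m`, the term that drives the energy of the sphere. The terms containing `B`
form the remainder. -/
theorem hasDerivWithinAt_correction {s : Set ℝ} {t : ℝ} {Em Dm Fm : ℝ → ℝ}
    (hlam : ∀ j ∈ S, 1 ≤ lam j) (hμ : 1 ≤ μ)
    (hD : ∀ j ∈ S, HasDerivWithinAt (fun t => D t j) (2 * b t * lam j * F t j + B t * E t j) s t)
    (hF : ∀ j ∈ S, HasDerivWithinAt (fun t => F t j) (-(2 * b t * lam j * D t j)) s t)
    (hDm : HasDerivWithinAt Dm (2 * b t * μ * Fm t + B t * Em t) s t)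
    (hFm : HasDerivWithinAt Fm (-(2 * b t * μ * Dm t)) s t)
    (hDs : Dm t = ∑ j ∈ S with lam j = μ, D t j) (hFs : Fm t = ∑ j ∈ S with lam j = μ, F t j) :
    HasDerivWithinAt (fun t => correction S lam μ (D t) (F t) (Dm t) (Fm t))
      (4 * b t * Dm t * (∑ j ∈ S, lam j ^ 2 * F t j) +
        B t * correctionRem S lam μ (E t) (D t) (Em t) (Dm t)) s t := by
  have h : HasDerivWithinAt (fun t => correction S lam μ (D t) (F t) (Dm t) (Fm t)) _ s t :=
    HasDerivWithinAt.fun_sum fun j hj =>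
      ((((hD j hj).mul hDm).sub ((hF j hj).mul hFm)).const_mul (lam j ^ 2 / (lam j + μ))).add
      ((((hD j hj).mul hDm).add ((hF j hj).mul hFm)).const_mul (lam j ^ 2 / (lam j - μ)))
  refine h.congr_deriv ?_
  -- Resonant modes contribute an error antisymmetric in `D` and `F`. Summed over the whole sphere
  -- it becomes `μ² (D_m F_m - F_m D_m) = 0`.
  have hres : ∑ j ∈ S, (if lam j = μ then lam j ^ 2 * (D t j * Fm t - F t j * Dm t) else 0) = 0 := by
    rw [← Finset.sum_filter]
    have : ∀ j ∈ S.filter (fun j => lam j = μ), lam j ^ 2 * (D t j * Fm t - F t j * Dm t) =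
        μ ^ 2 * (D t j * Fm t) - μ ^ 2 * (F t j * Dm t) := fun j hj => by
      rw [(Finset.mem_filter.1 hj).2]; ring
    rw [Finset.sum_congr rfl this, Finset.sum_sub_distrib, ← Finset.mul_sum, ← Finset.mul_sum,
      ← Finset.sum_mul, ← Finset.sum_mul, ← hDs, ← hFs]
    ring
  have key : ∀ j ∈ S,
      lam j ^ 2 / (lam j + μ) * ((2 * b t * lam j * F t j + B t * E t j) * Dm t +
          D t j * (2 * b t * μ * Fm t + B t * Em t) -
          (-(2 * b t * lam j * D t j) * Fm t + F t j * -(2 * b t * μ * Dm t))) +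
        lam j ^ 2 / (lam j - μ) * ((2 * b t * lam j * F t j + B t * E t j) * Dm t +
          D t j * (2 * b t * μ * Fm t + B t * Em t) +
          (-(2 * b t * lam j * D t j) * Fm t + F t j * -(2 * b t * μ * Dm t))) =
      4 * b t * Dm t * (lam j ^ 2 * F t j) +
      B t * ((lam j ^ 2 / (lam j + μ) + lam j ^ 2 / (lam j - μ)) * (E t j * Dm t + D t j * Em t)) +
      2 * b t * (if lam j = μ then lam j ^ 2 * (D t j * Fm t - F t j * Dm t) else 0) := by
    intro j hj
    have h1 : lam j + μ ≠ 0 := by have := hlam j hj; positivity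
    split_ifs with hjm
    · subst hjm
      -- Division by zero gives zero, so at resonance the second half of the correction is absent,
      -- which is the error treated in `hres`.
      simp only [sub_self, div_zero]
      field_simp
      ring
    · have h2 : lam j - μ ≠ 0 := sub_ne_zero.2 hjm
      field_simp
      ring
  rw [correctionRem, Finset.mul_sum, Finset.mul_sum]
  have hres' : ∑ j ∈ S, 2 * b t *
      (if lam j = μ then lam j ^ 2 * (D t j * Fm t - F t j * Dm t) else 0) = 0 := by
    rw [← Finset.mul_sum, hres, mul_zero]
  rw [Finset.sum_congr rfl key, Finset.sum_add_distrib, hres', add_zero, Finset.sum_add_distrib]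

/-- The factor is `4 = 1 + 3`: the sum denominator costs at most one and the difference denominator
at most `3ρ`. The loss falls on `x = λ_j` alone and not on `μ`, so the sum over `j` is controlled at
the threshold regularity, whatever the sphere. -/
theorem abs_coeff_le {x ρ : ℝ} (hx : 1 ≤ x) (hμ : 1 ≤ μ) (hρ : 1 ≤ ρ)
    (hgap : |x - μ|⁻¹ ≤ 3 * ρ) :
    |x ^ 2 / (x + μ)| + |x ^ 2 / (x - μ)| ≤ 4 * (x ^ 2 * ρ) := by
  have h1 : |x ^ 2 / (x + μ)| ≤ x ^ 2 * ρ := by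
    rw [abs_of_nonneg (by positivity), div_le_iff₀ (by linarith)]
    have : 0 ≤ x ^ 2 := sq_nonneg x
    nlinarith [mul_nonneg this (by nlinarith : 0 ≤ ρ * (x + μ) - 1)]
  have h2 : |x ^ 2 / (x - μ)| ≤ x ^ 2 * (3 * ρ) := by
    rw [abs_div, abs_of_nonneg (sq_nonneg x), div_eq_mul_inv]
    exact mul_le_mul_of_nonneg_left hgap (sq_nonneg x)
  linarith

theorem abs_correction_le {E D F : ι → ℝ} {Em Dm Fm : ℝ} (hlam : ∀ j ∈ S, 1 ≤ lam j)
    (hrho : ∀ j ∈ S, 1 ≤ rho j) (hμ : 1 ≤ μ) (hgap : ∀ j ∈ S, |lam j - μ|⁻¹ ≤ 3 * rho j)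
    (hDE : ∀ j ∈ S, |D j| ≤ E j) (hFE : ∀ j ∈ S, |F j| ≤ E j) (hDm : |Dm| ≤ Em) (hFm : |Fm| ≤ Em)
    (hM : ∑ j ∈ S, lam j ^ 2 * rho j * E j ≤ δ) :
    |correction S lam μ D F Dm Fm| ≤ 8 * δ * Em ∧
      |correctionRem S lam μ E D Em Dm| ≤ 8 * δ * Em := by
  have hEm : 0 ≤ Em := (abs_nonneg _).trans hDm
  have hsum : ∑ j ∈ S, 4 * (lam j ^ 2 * rho j) * (2 * (E j * Em)) ≤ 8 * δ * Em := by
    have : ∑ j ∈ S, 4 * (lam j ^ 2 * rho j) * (2 * (E j * Em)) =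
        8 * (∑ j ∈ S, lam j ^ 2 * rho j * E j) * Em := by
      rw [Finset.mul_sum, Finset.sum_mul]
      exact Finset.sum_congr rfl fun j _ => by ring
    rw [this]
    gcongr
  have hprod : ∀ {x y X : ℝ}, |x| ≤ X → |y| ≤ Em → |x * y| ≤ X * Em := fun hx hy => by
    rw [abs_mul]; exact mul_le_mul hx hy (abs_nonneg _) ((abs_nonneg _).trans hx)
  constructor
  · refine (Finset.abs_sum_le_sum_abs _ _).trans ((Finset.sum_le_sum fun j hj => ?_).trans hsum)
    have h1 := abs_coeff_le (hlam j hj) hμ (hrho j hj) (hgap j hj)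
    have hE : 0 ≤ E j * Em := mul_nonneg ((abs_nonneg _).trans (hDE j hj)) hEm
    have h2 : |D j * Dm - F j * Fm| ≤ 2 * (E j * Em) := by
      have := abs_sub (D j * Dm) (F j * Fm)
      have := hprod (hDE j hj) hDm
      have := hprod (hFE j hj) hFm
      linarith
    have h3 : |D j * Dm + F j * Fm| ≤ 2 * (E j * Em) := by
      have := abs_add_le (D j * Dm) (F j * Fm)
      have := hprod (hDE j hj) hDm
      have := hprod (hFE j hj) hFm
      linarith
    refine (abs_add_le _ _).trans ?_
    rw [abs_mul, abs_mul]
    calc _ ≤ |lam j ^ 2 / (lam j + μ)| * (2 * (E j * Em)) +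
          |lam j ^ 2 / (lam j - μ)| * (2 * (E j * Em)) := by gcongr
      _ = (|lam j ^ 2 / (lam j + μ)| + |lam j ^ 2 / (lam j - μ)|) * (2 * (E j * Em)) := by ring
      _ ≤ _ := by gcongr
  · refine (Finset.abs_sum_le_sum_abs _ _).trans ((Finset.sum_le_sum fun j hj => ?_).trans hsum)
    have h1 := abs_coeff_le (hlam j hj) hμ (hrho j hj) (hgap j hj)
    have hEj : 0 ≤ E j := (abs_nonneg _).trans (hDE j hj)
    have hE : 0 ≤ E j * Em := mul_nonneg hEj hEm
    have h2 : |E j * Dm + D j * Em| ≤ 2 * (E j * Em) := by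
      have := abs_add_le (E j * Dm) (D j * Em)
      have := hprod (abs_of_nonneg hEj).le hDm
      have := hprod (hDE j hj) (abs_of_nonneg hEm).le
      linarith
    rw [abs_mul]
    exact mul_le_mul ((abs_add_le _ _).trans h1) h2 (abs_nonneg _) (by
      have := hrho j hj; positivity)

/-- Growth of the energy on one sphere: its time derivative is, up to a small correction of the
energy, of fourth order in the solution. -/
theorem sphere_energy_le (hlam : ∀ j ∈ S, 1 ≤ lam j)
    (hrho : ∀ j ∈ S, 1 ≤ rho j) (hμ : 1 ≤ μ) (hgap : ∀ j ∈ S, |lam j - μ|⁻¹ ≤ 3 * rho j)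
    (hb : ∀ t ∈ Icc 0 T, 1 ≤ b t)
    (hb' : ∀ t ∈ Icc 0 T, HasDerivWithinAt b (B t * b t) (Icc 0 T) t)
    (hB : ∀ t ∈ Icc 0 T, 2 * b t ^ 2 * B t = ∑ j ∈ S, lam j ^ 2 * F t j)
    (hE : ∀ t ∈ Icc 0 T, ∀ j ∈ S, HasDerivWithinAt (fun t => E t j) (B t * D t j) (Icc 0 T) t)
    (hD : ∀ t ∈ Icc 0 T, ∀ j ∈ S, HasDerivWithinAt (fun t => D t j)
      (2 * b t * lam j * F t j + B t * E t j) (Icc 0 T) t)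
    (hF : ∀ t ∈ Icc 0 T, ∀ j ∈ S, HasDerivWithinAt (fun t => F t j)
      (-(2 * b t * lam j * D t j)) (Icc 0 T) t)
    (hDE : ∀ t ∈ Icc 0 T, ∀ j ∈ S, |D t j| ≤ E t j)
    (hFE : ∀ t ∈ Icc 0 T, ∀ j ∈ S, |F t j| ≤ E t j)
    (hδ0 : 0 ≤ δ) (hδ : δ ≤ 1 / 2) (hM : ∀ t ∈ Icc 0 T, ∑ j ∈ S, lam j ^ 2 * rho j * E t j ≤ δ)
    {t : ℝ} (ht : t ∈ Icc 0 T) :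
    ∑ j ∈ S with lam j = μ, E t j ≤
      3 * Real.exp (4 * δ ^ 2 * t) * ∑ j ∈ S with lam j = μ, E 0 j := by
  classical
  set Em : ℝ → ℝ := fun t => ∑ j ∈ S with lam j = μ, E t j with hEm
  set Dm : ℝ → ℝ := fun t => ∑ j ∈ S with lam j = μ, D t j with hDm
  set Fm : ℝ → ℝ := fun t => ∑ j ∈ S with lam j = μ, F t j with hFm
  have hsub : ∀ j ∈ S.filter (fun j => lam j = μ), j ∈ S := fun j hj => (Finset.mem_filter.1 hj).1
  have dE : ∀ t ∈ Icc 0 T, HasDerivWithinAt Em (B t * Dm t) (Icc 0 T) t := fun t ht => by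
    refine (HasDerivWithinAt.fun_sum fun j hj => hE t ht j (hsub j hj)).congr_deriv ?_
    rw [hDm, Finset.mul_sum]
  have dD : ∀ t ∈ Icc 0 T, HasDerivWithinAt Dm (2 * b t * μ * Fm t + B t * Em t) (Icc 0 T) t :=
    fun t ht => by
    refine (HasDerivWithinAt.fun_sum fun j hj => hD t ht j (hsub j hj)).congr_deriv ?_
    rw [hFm, hEm, Finset.mul_sum, Finset.mul_sum, ← Finset.sum_add_distrib]
    exact Finset.sum_congr rfl fun j hj => by rw [(Finset.mem_filter.1 hj).2]
  have dF : ∀ t ∈ Icc 0 T, HasDerivWithinAt Fm (-(2 * b t * μ * Dm t)) (Icc 0 T) t :=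
    fun t ht => by
    refine (HasDerivWithinAt.fun_sum fun j hj => hF t ht j (hsub j hj)).congr_deriv ?_
    rw [hDm, Finset.mul_sum, ← Finset.sum_neg_distrib]
    exact Finset.sum_congr rfl fun j hj => by rw [(Finset.mem_filter.1 hj).2]
  have hDEm : ∀ t ∈ Icc 0 T, |Dm t| ≤ Em t := fun t ht =>
    (Finset.abs_sum_le_sum_abs _ _).trans (Finset.sum_le_sum fun j hj => hDE t ht j (hsub j hj))
  have hFEm : ∀ t ∈ Icc 0 T, |Fm t| ≤ Em t := fun t ht =>
    (Finset.abs_sum_le_sum_abs _ _).trans (Finset.sum_le_sum fun j hj => hFE t ht j (hsub j hj))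
  set Q : ℝ → ℝ := fun t => correction S lam μ (D t) (F t) (Dm t) (Fm t) with hQ
  set R : ℝ → ℝ := fun t => correctionRem S lam μ (E t) (D t) (Em t) (Dm t) with hR
  have hQR : ∀ t ∈ Icc 0 T, |Q t| ≤ 8 * δ * Em t ∧ |R t| ≤ 8 * δ * Em t := fun t ht =>
    abs_correction_le hlam hrho hμ hgap (hDE t ht) (hFE t ht) (hDEm t ht) (hFEm t ht) (hM t ht)
  have hEm0 : ∀ t ∈ Icc 0 T, 0 ≤ Em t := fun t ht => (abs_nonneg _).trans (hDEm t ht)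
  -- `2b²B` is the sum of the `λ² F`, bounded by the weighted energy, and `b ≥ 1`.
  have hBδ : ∀ t ∈ Icc 0 T, |B t| ≤ δ / 2 := fun t ht => by
    have h1 : |∑ j ∈ S, lam j ^ 2 * F t j| ≤ δ := by
      refine (Finset.abs_sum_le_sum_abs _ _).trans ((Finset.sum_le_sum fun j hj => ?_).trans
        (hM t ht))
      rw [abs_mul, abs_of_nonneg (sq_nonneg (lam j)), mul_assoc]
      gcongr
      have := hrho j hj
      have := hFE t ht j hj
      nlinarith [abs_nonneg (F t j)]
    rw [← hB t ht, abs_mul, abs_of_nonneg (by positivity)] at h1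
    have hb2 : 1 ≤ b t ^ 2 := one_le_pow₀ (hb t ht)
    nlinarith [abs_nonneg (B t)]
  -- The factor `(8b³)⁻¹` turns `4b D_m ∑ λ² F = 8b³ B D_m` into `B D_m`, which is exactly `E_m'`.
  -- The term `3Q` in the derivative below comes from differentiating `b⁻³`.
  set G : ℝ → ℝ := fun t => Em t - (8 * b t ^ 3)⁻¹ * Q t with hG
  have dG : ∀ t ∈ Icc 0 T,
      HasDerivWithinAt G (-(B t * (8 * b t ^ 3)⁻¹ * (R t - 3 * Q t))) (Icc 0 T) t := fun t ht => by
    have hbt : b t ≠ 0 := (zero_lt_one.trans_le (hb t ht)).ne'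
    have dQ := hasDerivWithinAt_correction (E := E) (B := B) hlam hμ (hD t ht) (hF t ht) (dD t ht)
      (dF t ht) rfl rfl
    have dinv := (((hb' t ht).pow 3).const_mul 8).inv (by simpa using hbt)
    refine ((dE t ht).sub (dinv.mul dQ)).congr_deriv ?_
    rw [← hB t ht]
    simp only [hQ, hR, Pi.pow_apply, Pi.inv_apply]
    field_simp
    ring
  have hinv : ∀ t ∈ Icc 0 T, 0 ≤ (8 * b t ^ 3)⁻¹ ∧ (8 * b t ^ 3)⁻¹ ≤ 1 / 8 := fun t ht => by
    have hb3 : 1 ≤ b t ^ 3 := one_le_pow₀ (hb t ht)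
    refine ⟨by positivity, ?_⟩
    rw [inv_le_comm₀ (by positivity) (by norm_num)]
    linarith
  have hGE : ∀ t ∈ Icc 0 T, |(8 * b t ^ 3)⁻¹ * Q t| ≤ Em t / 2 := fun t ht => by
    rw [abs_mul, abs_of_nonneg (hinv t ht).1]
    calc _ ≤ 1 / 8 * (8 * δ * Em t) :=
          mul_le_mul (hinv t ht).2 (hQR t ht).1 (abs_nonneg _) (by norm_num)
      _ ≤ _ := by nlinarith [hEm0 t ht]
  have hG' : ∀ t ∈ Icc 0 T,
      -(B t * (8 * b t ^ 3)⁻¹ * (R t - 3 * Q t)) ≤ 4 * δ ^ 2 * G t := fun t ht => by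
    -- The right side is `2δ² E_m`, and `E_m ≤ 2G`; hence the rate `4δ²`.
    have h1 : |B t * (8 * b t ^ 3)⁻¹ * (R t - 3 * Q t)| ≤ δ / 2 * (1 / 8) * (32 * δ * Em t) := by
      rw [abs_mul, abs_mul, abs_of_nonneg (hinv t ht).1]
      have h2 : |R t - 3 * Q t| ≤ 32 * δ * Em t := by
        have h3 := abs_sub (R t) (3 * Q t)
        rw [abs_mul, abs_of_pos (by norm_num : (0 : ℝ) < 3)] at h3
        linarith [(hQR t ht).1, (hQR t ht).2]
      exact mul_le_mul (mul_le_mul (hBδ t ht) (hinv t ht).2 (hinv t ht).1 (by positivity)) h2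
        (abs_nonneg _) (by positivity)
    have h4 : Em t / 2 ≤ G t := by
      have := (abs_le.1 (hGE t ht)).2
      simp only [hG]; linarith
    have h5 := (abs_le.1 h1).1
    nlinarith [mul_le_mul_of_nonneg_left h4 (by positivity : 0 ≤ 4 * δ ^ 2)]
  have hmain := le_exp_mul_of_deriv_le dG hG' ht
  have h0 : (0 : ℝ) ∈ Icc 0 T := ⟨le_rfl, ht.1.trans ht.2⟩
  have e1 : Em t / 2 ≤ G t := by
    have := (abs_le.1 (hGE t ht)).2
    simp only [hG]; linarith
  have e2 : G 0 ≤ 3 / 2 * Em 0 := by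
    have := (abs_le.1 (hGE 0 h0)).1
    simp only [hG]; linarith
  -- The constant `3` is the ratio of the bounds `G 0 ≤ (3/2) E_m(0)` and `G ≥ E_m / 2`.
  have e3 := mul_le_mul_of_nonneg_left e2 (Real.exp_pos (4 * δ ^ 2 * t)).le
  change Em t ≤ _ * Em 0
  linarith

end NormalForm

/-! ## Finitely many interacting modes -/

/-- `u` with `v = u'` solves `u'' + a(t) l² u = 0` on `[0,T]`. -/
def IsMode (T : ℝ) (a : ℝ → ℝ) (l : ℝ) (u v : ℝ → ℂ) : Prop :=
  ∀ t ∈ Icc 0 T, HasDerivWithinAt u (v t) (Icc 0 T) t ∧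
    HasDerivWithinAt v (-(a t * l ^ 2) • u t) (Icc 0 T) t

theorem IsMode.mono {T T' l : ℝ} {a : ℝ → ℝ} {u v : ℝ → ℂ} (h : IsMode T a l u v) (hT : T' ≤ T) :
    IsMode T' a l u v := fun t ht =>
  have hsub : Icc 0 T' ⊆ Icc 0 T := Icc_subset_Icc le_rfl hT
  ⟨(h t (hsub ht)).1.mono hsub, (h t (hsub ht)).2.mono hsub⟩

/-- The energy of a mode, at the regularity `H^{1/2} × H^{-1/2}`. -/
noncomputable def modeEnergy (l : ℝ) (u v : ℂ) : ℝ := l * ‖u‖ ^ 2 + ‖v‖ ^ 2 / l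

theorem modeEnergy_nonneg {l : ℝ} (hl : 1 ≤ l) (u v : ℂ) : 0 ≤ modeEnergy l u v := by
  unfold modeEnergy; positivity

/-- The difference between `modeEnergy` and `2‖u‖‖v‖` is `(l‖u‖ - ‖v‖)² / l`. -/
theorem two_mul_abs_inner_le {l : ℝ} (hl : 0 < l) (u v : ℂ) :
    |2 * inner ℝ u v| ≤ modeEnergy l u v := by
  have h1 : |inner ℝ u v| ≤ ‖u‖ * ‖v‖ := abs_real_inner_le_norm u v
  have h2 : 2 * (‖u‖ * ‖v‖) ≤ modeEnergy l u v := by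
    unfold modeEnergy
    rw [← sub_nonneg]
    have : l * ‖u‖ ^ 2 + ‖v‖ ^ 2 / l - 2 * (‖u‖ * ‖v‖) = (l * ‖u‖ - ‖v‖) ^ 2 / l := by
      field_simp; ring
    rw [this]; positivity
  rw [abs_mul, abs_two]; linarith

theorem modeEnergy_mul_le {l b : ℝ} (hl : 1 ≤ l) (hb : 1 ≤ b) (u v : ℂ) :
    modeEnergy (b * l) u v ≤ b * modeEnergy l u v := by
  unfold modeEnergy
  have h1 : ‖v‖ ^ 2 / (b * l) ≤ b * (‖v‖ ^ 2 / l) := by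
    have : 0 ≤ ‖v‖ ^ 2 / l := by positivity
    rw [mul_comm b l, ← div_div, div_le_iff₀ (by positivity)]
    nlinarith [mul_nonneg this (by nlinarith : 0 ≤ b * b - 1)]
  linarith

theorem modeEnergy_le_mul {l b : ℝ} (hl : 1 ≤ l) (hb : 1 ≤ b) (u v : ℂ) :
    modeEnergy l u v ≤ b * modeEnergy (b * l) u v := by
  unfold modeEnergy
  have h1 : b * (‖v‖ ^ 2 / (b * l)) = ‖v‖ ^ 2 / l := by field_simp
  have h2 : l * ‖u‖ ^ 2 ≤ b * (b * l * ‖u‖ ^ 2) := by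
    have : 0 ≤ l * ‖u‖ ^ 2 := by positivity
    nlinarith [mul_nonneg this (by nlinarith : 0 ≤ b * b - 1)]
  linarith

section Galerkin

variable {ι : Type*} {S : Finset ι} {lam : ι → ℝ} {r : ℝ → ℝ} {T η : ℝ} {U V : ι → ℝ → ℂ}
  {a : ℝ → ℝ}

theorem hasDerivWithinAt_coefficient (hmode : ∀ j ∈ S, IsMode T a (lam j) (U j) (V j))
    (ha : ∀ t ∈ Icc 0 T, a t = 1 + ∑ j ∈ S, lam j ^ 2 * ‖U j t‖ ^ 2) {t : ℝ} (ht : t ∈ Icc 0 T) :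
    HasDerivWithinAt a (∑ j ∈ S, lam j ^ 2 * (2 * inner ℝ (U j t) (V j t))) (Icc 0 T) t :=
  ((HasDerivWithinAt.fun_sum fun j hj =>
    ((hmode j hj t ht).1.norm_sq.const_mul (lam j ^ 2))).const_add 1).congr ha (ha t ht)

/-- If the energy stays small, weighted energies grow at most by a constant factor. -/
theorem weighted_energy_le_of_small {δ : ℝ} (hmode : ∀ j ∈ S, IsMode T a (lam j) (U j) (V j))
    (ha : ∀ t ∈ Icc 0 T, a t = 1 + ∑ j ∈ S, lam j ^ 2 * ‖U j t‖ ^ 2)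
    (hlam : ∀ j ∈ S, 1 ≤ lam j) (hr : ∀ j ∈ S, 1 ≤ r (lam j))
    (hgap : ∀ j ∈ S, ∀ k ∈ S, |lam j - lam k|⁻¹ ≤ 3 * r (lam j))
    (hδ0 : 0 ≤ δ) (hδ : δ ≤ 1 / 2)
    (hM : ∀ t ∈ Icc 0 T, ∑ j ∈ S, lam j ^ 2 * r (lam j) *
      modeEnergy (√(a t) * lam j) (U j t) (V j t) ≤ δ)
    (hT : 4 * δ ^ 2 * T ≤ 1) {w : ℝ → ℝ} (hw : ∀ x, 0 ≤ w x) {t : ℝ} (ht : t ∈ Icc 0 T) :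
    ∑ j ∈ S, w (lam j) * modeEnergy (√(a t) * lam j) (U j t) (V j t) ≤
      9 * ∑ j ∈ S, w (lam j) * modeEnergy (√(a 0) * lam j) (U j 0) (V j 0) := by
  classical
  have ha1 : ∀ t ∈ Icc 0 T, 1 ≤ a t := fun t ht => by
    rw [ha t ht, le_add_iff_nonneg_right]; positivity
  set F : ℝ → ι → ℝ := fun t j => 2 * inner ℝ (U j t) (V j t) with hF
  set b : ℝ → ℝ := fun t => √(a t) with hb
  -- This is `a' / (2a)`, the logarithmic derivative of `b = √a`.
  set B : ℝ → ℝ := fun t => (∑ j ∈ S, lam j ^ 2 * F t j) / (2 * a t) with hB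
  set E : ℝ → ι → ℝ := fun t j => modeEnergy (b t * lam j) (U j t) (V j t) with hE
  set D : ℝ → ι → ℝ := fun t j => b t * lam j * ‖U j t‖ ^ 2 - ‖V j t‖ ^ 2 / (b t * lam j) with hD
  have hb1 : ∀ t ∈ Icc 0 T, 1 ≤ b t := fun t ht => Real.one_le_sqrt.2 (ha1 t ht)
  have hb2 : ∀ t ∈ Icc 0 T, b t ^ 2 = a t := fun t ht =>
    Real.sq_sqrt (zero_le_one.trans (ha1 t ht))
  have db : ∀ t ∈ Icc 0 T, HasDerivWithinAt b (B t * b t) (Icc 0 T) t := fun t ht => by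
    have hbt : b t ≠ 0 := (zero_lt_one.trans_le (hb1 t ht)).ne'
    refine ((hasDerivWithinAt_coefficient hmode ha ht).sqrt
      (zero_lt_one.trans_le (ha1 t ht)).ne').congr_deriv ?_
    simp only [hB, hF, ← hb2 t ht, Real.sqrt_sq (zero_le_one.trans (hb1 t ht))]
    generalize ∑ j ∈ S, lam j ^ 2 * (2 * inner ℝ (U j t) (V j t)) = A
    field_simp
  have dvar : ∀ t ∈ Icc 0 T, ∀ j ∈ S,
      HasDerivWithinAt (fun t => b t * lam j * ‖U j t‖ ^ 2)
        (B t * (b t * lam j * ‖U j t‖ ^ 2) + b t * lam j * F t j) (Icc 0 T) t ∧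
      HasDerivWithinAt (fun t => ‖V j t‖ ^ 2 / (b t * lam j))
        (-B t * (‖V j t‖ ^ 2 / (b t * lam j)) - b t * lam j * F t j) (Icc 0 T) t := by
    intro t ht j hj
    have hbt : b t ≠ 0 := (zero_lt_one.trans_le (hb1 t ht)).ne'
    have hl : lam j ≠ 0 := (zero_lt_one.trans_le (hlam j hj)).ne'
    constructor
    · refine (((db t ht).mul_const (lam j)).mul (hmode j hj t ht).1.norm_sq).congr_deriv ?_
      simp only [hF]; ring
    · refine ((hmode j hj t ht).2.norm_sq.div ((db t ht).mul_const (lam j))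
        (mul_ne_zero hbt hl)).congr_deriv ?_
      simp only [hF, inner_smul_right, ← hb2 t ht, real_inner_comm (U j t) (V j t)]
      field_simp
      ring
  have habs : ∀ t ∈ Icc 0 T, ∀ j ∈ S, |D t j| ≤ E t j ∧ |F t j| ≤ E t j := by
    intro t ht j hj
    have hbl : 0 < b t * lam j :=
      mul_pos (zero_lt_one.trans_le (hb1 t ht)) (zero_lt_one.trans_le (hlam j hj))
    refine ⟨?_, two_mul_abs_inner_le hbl _ _⟩
    have h1 : 0 ≤ b t * lam j * ‖U j t‖ ^ 2 := by positivity
    have h2 : 0 ≤ ‖V j t‖ ^ 2 / (b t * lam j) := by positivity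
    simp only [hD, hE, modeEnergy]
    rw [abs_le]; constructor <;> linarith
  have hsphere : ∀ μ ∈ S.image lam, ∑ j ∈ S with lam j = μ, E t j ≤
      9 * ∑ j ∈ S with lam j = μ, E 0 j := by
    intro μ hμ
    obtain ⟨k, hk, rfl⟩ := Finset.mem_image.1 hμ
    have h0 : (0 : ℝ) ∈ Icc 0 T := ⟨le_rfl, ht.1.trans ht.2⟩
    have := sphere_energy_le (rho := fun j => r (lam j)) (μ := lam k) (b := b) (B := B)
      (E := E) (D := D) (F := F) (T := T) (δ := δ) hlam hr (hlam k hk) (fun j hj => hgap j hj k hk)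
      hb1 db
      (fun t ht => by
        have := (zero_lt_one.trans_le (ha1 t ht)).ne'
        simp only [hB, hb2 t ht]; field_simp)
      (fun t ht j hj => ((dvar t ht j hj).1.add (dvar t ht j hj).2).congr_deriv (by
        simp only [hD]; ring))
      (fun t ht j hj => ((dvar t ht j hj).1.sub (dvar t ht j hj).2).congr_deriv (by
        simp only [hE, modeEnergy]; ring))
      (fun t ht j hj => by
        have hbt : b t ≠ 0 := (zero_lt_one.trans_le (hb1 t ht)).ne'
        have hl : lam j ≠ 0 := (zero_lt_one.trans_le (hlam j hj)).ne'
        refine (((hmode j hj t ht).1.inner ℝ (hmode j hj t ht).2).const_mul 2).congr_deriv ?_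
        simp only [hD, inner_smul_right, real_inner_self_eq_norm_sq, ← hb2 t ht]
        field_simp
        ring)
      (fun t ht j hj => (habs t ht j hj).1) (fun t ht j hj => (habs t ht j hj).2) hδ0 hδ hM ht
    refine this.trans ?_
    -- Since `e < 3`, the factor on one sphere is at most `3 · 3 = 9`.
    have hexp : Real.exp (4 * δ ^ 2 * t) ≤ 3 := by
      have h1 : 4 * δ ^ 2 * t ≤ 1 :=
        (mul_le_mul_of_nonneg_left ht.2 (by positivity)).trans hT
      have := Real.exp_le_exp.2 h1
      have := Real.exp_one_lt_d9
      linarith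
    have hE0 : 0 ≤ ∑ j ∈ S with lam j = lam k, E 0 j := Finset.sum_nonneg fun j hj =>
      (abs_nonneg _).trans (habs 0 h0 j (Finset.mem_filter.1 hj).1).1
    nlinarith
  -- The weight is constant on spheres, so estimates on single spheres add up to an estimate for
  -- every weight with the same constant.
  have hfib : ∀ s, ∑ j ∈ S, w (lam j) * E s j =
      ∑ μ ∈ S.image lam, w μ * ∑ j ∈ S with lam j = μ, E s j := fun s => by
    rw [← Finset.sum_fiberwise_of_maps_to (fun j hj => Finset.mem_image_of_mem lam hj)]
    refine Finset.sum_congr rfl fun μ _ => ?_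
    rw [Finset.mul_sum]
    exact Finset.sum_congr rfl fun j hj => by rw [(Finset.mem_filter.1 hj).2]
  change ∑ j ∈ S, w (lam j) * E t j ≤ 9 * ∑ j ∈ S, w (lam j) * E 0 j
  rw [hfib, hfib, Finset.mul_sum]
  refine Finset.sum_le_sum fun μ hμ => ?_
  have := mul_le_mul_of_nonneg_left (hsphere μ hμ) (hw μ)
  linarith

/-- Weighted energies of a small solution with finitely many modes stay bounded for times of
order `η ^ (-2)`, where `η` bounds the initial energy. -/
theorem weighted_energy_le (hmode : ∀ j ∈ S, IsMode T a (lam j) (U j) (V j))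
    (ha : ∀ t ∈ Icc 0 T, a t = 1 + ∑ j ∈ S, lam j ^ 2 * ‖U j t‖ ^ 2)
    (hlam : ∀ j ∈ S, 1 ≤ lam j) (hr : ∀ j ∈ S, 1 ≤ r (lam j))
    (hgap : ∀ j ∈ S, ∀ k ∈ S, |lam j - lam k|⁻¹ ≤ 3 * r (lam j))
    (hη0 : 0 < η) (hη : η ≤ 1 / 100) (hT : T * η ^ 2 ≤ 1 / 1600)
    (hinit : ∑ j ∈ S, lam j ^ 2 * r (lam j) * modeEnergy (lam j) (U j 0) (V j 0) ≤ η)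
    {w : ℝ → ℝ} (hw : ∀ x, 0 ≤ w x) {t : ℝ} (ht : t ∈ Icc 0 T) :
    ∑ j ∈ S, w (lam j) * modeEnergy (lam j) (U j t) (V j t) ≤
      36 * ∑ j ∈ S, w (lam j) * modeEnergy (lam j) (U j 0) (V j 0) := by
  have hT0 : 0 ≤ T := ht.1.trans ht.2
  have h0 : (0 : ℝ) ∈ Icc 0 T := ⟨le_rfl, hT0⟩
  have ha1 : ∀ t ∈ Icc 0 T, 1 ≤ a t := fun t ht => by
    rw [ha t ht, le_add_iff_nonneg_right]; positivity
  have hb1 : ∀ t ∈ Icc 0 T, 1 ≤ √(a t) := fun t ht => Real.one_le_sqrt.2 (ha1 t ht)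
  set M : ℝ → ℝ := fun t => ∑ j ∈ S, lam j ^ 2 * r (lam j) *
      modeEnergy (√(a t) * lam j) (U j t) (V j t) with hM
  have hEnn : ∀ t ∈ Icc 0 T, ∀ j ∈ S, 0 ≤ modeEnergy (√(a t) * lam j) (U j t) (V j t) :=
    fun t ht j hj => modeEnergy_nonneg (one_le_mul_of_one_le_of_one_le (hb1 t ht) (hlam j hj)) _ _
  have hbsmall : ∀ t ∈ Icc 0 T, M t ≤ 1 → √(a t) ≤ 2 := fun t ht hMt => by
    rw [Real.sqrt_le_left (by norm_num), ha t ht]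
    have : ∑ j ∈ S, lam j ^ 2 * ‖U j t‖ ^ 2 ≤ M t := Finset.sum_le_sum fun j hj => by
      rw [mul_assoc]
      gcongr
      have h1 : 0 ≤ ‖V j t‖ ^ 2 / (√(a t) * lam j) := by
        have := hlam j hj; positivity
      have h2 : 1 ≤ √(a t) * lam j := one_le_mul_of_one_le_of_one_le (hb1 t ht) (hlam j hj)
      have h3 : ‖U j t‖ ^ 2 ≤ modeEnergy (√(a t) * lam j) (U j t) (V j t) := by
        unfold modeEnergy; nlinarith [sq_nonneg ‖U j t‖]
      nlinarith [hr j hj, hEnn t ht j hj]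
    linarith
  have hb0 : √(a 0) ≤ 2 := by
    rw [Real.sqrt_le_left (by norm_num), ha 0 h0]
    have : ∑ j ∈ S, lam j ^ 2 * ‖U j 0‖ ^ 2 ≤
        ∑ j ∈ S, lam j ^ 2 * r (lam j) * modeEnergy (lam j) (U j 0) (V j 0) :=
      Finset.sum_le_sum fun j hj => by
        rw [mul_assoc]
        gcongr
        have h1 : 0 ≤ ‖V j 0‖ ^ 2 / lam j := by
          have := hlam j hj; positivity
        have h3 : ‖U j 0‖ ^ 2 ≤ modeEnergy (lam j) (U j 0) (V j 0) := by
          unfold modeEnergy; nlinarith [sq_nonneg ‖U j 0‖, hlam j hj]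
        nlinarith [hr j hj, modeEnergy_nonneg (hlam j hj) (U j 0) (V j 0)]
    linarith
  have hinit0 : ∀ {w : ι → ℝ}, (∀ j ∈ S, 0 ≤ w j) →
      ∑ j ∈ S, w j * modeEnergy (√(a 0) * lam j) (U j 0) (V j 0) ≤
        2 * ∑ j ∈ S, w j * modeEnergy (lam j) (U j 0) (V j 0) := fun {w} hw => by
    rw [Finset.mul_sum]
    refine Finset.sum_le_sum fun j hj => ?_
    have h1 := modeEnergy_mul_le (hlam j hj) (hb1 0 h0) (U j 0) (V j 0)
    have h2 := mul_le_mul_of_nonneg_right hb0 (modeEnergy_nonneg (hlam j hj) (U j 0) (V j 0))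
    have := mul_le_mul_of_nonneg_left (h1.trans h2) (hw j hj)
    linarith
  have hwr : ∀ j ∈ S, 0 ≤ lam j ^ 2 * r (lam j) := fun j hj => by
    have := hr j hj; positivity
  have hM0 : M 0 ≤ 2 * η := (hinit0 hwr).trans (by linarith)
  -- The bootstrap level is `20η`: the initial value is at most `2η`, growth by `9` gives `18η`, and
  -- `4 · 20² = 1600` fixes the time constant.
  have hTt : ∀ t ∈ Icc 0 T, 4 * (20 * η) ^ 2 * t ≤ 1 := fun t ht => by
    have := mul_le_mul_of_nonneg_right ht.2 (sq_nonneg η)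
    nlinarith
  have hgrow : ∀ t ∈ Icc 0 T, (∀ s ∈ Icc 0 t, M s ≤ 20 * η) → ∀ w : ℝ → ℝ, (∀ x, 0 ≤ w x) →
      ∑ j ∈ S, w (lam j) * modeEnergy (√(a t) * lam j) (U j t) (V j t) ≤
        9 * ∑ j ∈ S, w (lam j) * modeEnergy (√(a 0) * lam j) (U j 0) (V j 0) :=
    fun t ht hs w hw => weighted_energy_le_of_small (r := r)
      (fun j hj => (hmode j hj).mono ht.2)
      (fun s hs => ha s ⟨hs.1, hs.2.trans ht.2⟩) hlam hr hgap (by positivity) (by linarith) hs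
      (hTt t ht) hw ⟨ht.1, le_rfl⟩
  have hcont : ContinuousOn M (Icc 0 T) := by
    have hac : ContinuousOn a (Icc 0 T) := fun t ht =>
      (hasDerivWithinAt_coefficient hmode ha ht).continuousWithinAt
    refine continuousOn_finsetSum _ fun j hj => continuousOn_const.mul ?_
    have hU : ContinuousOn (U j) (Icc 0 T) := fun t ht => (hmode j hj t ht).1.continuousWithinAt
    have hV : ContinuousOn (V j) (Icc 0 T) := fun t ht => (hmode j hj t ht).2.continuousWithinAt
    have hbl : ContinuousOn (fun t => √(a t) * lam j) (Icc 0 T) := hac.sqrt.mul continuousOn_const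
    refine (hbl.mul (hU.norm.pow 2)).add ((hV.norm.pow 2).div hbl fun t ht => ?_)
    exact (zero_lt_one.trans_le
      (one_le_mul_of_one_le_of_one_le (hb1 t ht) (hlam j hj))).ne'
  have hMlt : ∀ t ∈ Icc 0 T, M t < 20 * η := by
    refine lt_of_bootstrap hcont (by linarith) fun t ht hs => ?_
    -- The maximum makes the weight nonnegative on all reals; on the frequencies it changes nothing,
    -- as `r ≥ 1` there.
    have := hgrow t ht hs (fun x => x ^ 2 * max (r x) 0) (fun x => by positivity)
    have hmax : ∀ s, ∑ j ∈ S, (lam j ^ 2 * max (r (lam j)) 0) *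
        modeEnergy (√(a s) * lam j) (U j s) (V j s) = M s := fun s =>
      Finset.sum_congr rfl fun j hj => by rw [max_eq_left (zero_le_one.trans (hr j hj))]
    rw [hmax, hmax] at this
    linarith
  have hfin := hgrow t ht (fun s hs => (hMlt s ⟨hs.1, hs.2.trans ht.2⟩).le) w hw
  have hbt := hbsmall t ht ((hMlt t ht).le.trans (by linarith))
  have hlast : ∑ j ∈ S, w (lam j) * modeEnergy (lam j) (U j t) (V j t) ≤
      2 * ∑ j ∈ S, w (lam j) * modeEnergy (√(a t) * lam j) (U j t) (V j t) := by
    rw [Finset.mul_sum]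
    refine Finset.sum_le_sum fun j hj => ?_
    have h1 := modeEnergy_le_mul (hlam j hj) (hb1 t ht) (U j t) (V j t)
    have h2 := mul_le_mul_of_nonneg_right hbt (hEnn t ht j hj)
    have := mul_le_mul_of_nonneg_left (h1.trans h2) (hw (lam j))
    linarith
  -- The constant is `36 = 2 · 9 · 2`: each passage between the energies with and without `√a` costs
  -- `2`.
  have hi := hinit0 (w := fun j => w (lam j)) (fun j _ => hw _)
  linarith

end Galerkin

/-! ## Existence for finitely many modes -/

/-- The vector field of the Kirchhoff equation restricted to finitely many modes. -/
noncomputable def galerkinField {κ : Type*} [Fintype κ] (lam : κ → ℝ)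
    (x : (κ → ℂ) × (κ → ℂ)) : (κ → ℂ) × (κ → ℂ) :=
  (x.2, fun j => -((1 + ∑ k, lam k ^ 2 * ‖x.1 k‖ ^ 2) * lam j ^ 2) • x.1 j)

theorem contDiff_galerkinField {κ : Type*} [Fintype κ] (lam : κ → ℝ) :
    ContDiff ℝ 1 (galerkinField lam) := by
  have h1 : ∀ j, ContDiff ℝ 1 fun x : (κ → ℂ) × (κ → ℂ) => x.1 j := fun j =>
    (contDiff_apply ℝ ℂ j).comp contDiff_fst
  refine contDiff_snd.prodMk (contDiff_pi.2 fun j => ?_)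
  have h2 : ContDiff ℝ 1 fun x : (κ → ℂ) × (κ → ℂ) =>
      -((1 + ∑ k, lam k ^ 2 * ‖x.1 k‖ ^ 2) * lam j ^ 2) :=
    ((contDiff_const.add
      (ContDiff.sum fun k _ => contDiff_const.mul ((h1 k).norm_sq ℝ))).mul contDiff_const).neg
  exact h2.smul (h1 j)

/-- Solutions with finitely many modes are global, by conservation of the Hamiltonian. -/
theorem exists_galerkin_fintype {κ : Type*} [Fintype κ] {lam : κ → ℝ} (hlam : ∀ j, 1 ≤ lam j)
    {T : ℝ} (hT : 0 < T) (x₀ : (κ → ℂ) × (κ → ℂ)) :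
    ∃ x : ℝ → (κ → ℂ) × (κ → ℂ), x 0 = x₀ ∧
      ∀ t ∈ Icc 0 T, HasDerivWithinAt x (galerkinField lam (x t)) (Icc 0 T) t := by
  classical
  set N : (κ → ℂ) × (κ → ℂ) → ℝ := fun x => ∑ k, lam k ^ 2 * ‖x.1 k‖ ^ 2 with hN
  set H : (κ → ℂ) × (κ → ℂ) → ℝ := fun x => ∑ k, ‖x.2 k‖ ^ 2 + (N x + N x ^ 2 / 2) with hH
  have hN0 : ∀ x, 0 ≤ N x := fun x => by positivity
  have hnorm : ∀ x, ‖x‖ ≤ √(H x) := fun x => by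
    refine norm_prod_le_iff.2 ⟨(pi_norm_le_iff_of_nonneg (Real.sqrt_nonneg _)).2 fun j => ?_,
      (pi_norm_le_iff_of_nonneg (Real.sqrt_nonneg _)).2 fun j => ?_⟩ <;> apply Real.le_sqrt_of_sq_le
    · have h1 : lam j ^ 2 * ‖x.1 j‖ ^ 2 ≤ N x :=
        Finset.single_le_sum (f := fun k => lam k ^ 2 * ‖x.1 k‖ ^ 2)
          (fun k _ => by positivity) (Finset.mem_univ j)
      have h2 : ‖x.1 j‖ ^ 2 ≤ lam j ^ 2 * ‖x.1 j‖ ^ 2 :=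
        le_mul_of_one_le_left (by positivity) (one_le_pow₀ (hlam j))
      have h3 : 0 ≤ ∑ k, ‖x.2 k‖ ^ 2 := by positivity
      have h4 := hN0 x
      simp only [hH]; nlinarith
    · have h1 : ‖x.2 j‖ ^ 2 ≤ ∑ k, ‖x.2 k‖ ^ 2 :=
        Finset.single_le_sum (f := fun k => ‖x.2 k‖ ^ 2)
          (fun k _ => by positivity) (Finset.mem_univ j)
      have h4 := hN0 x
      simp only [hH]; nlinarith
  -- The cutoff equals one on a ball containing the level set of the Hamiltonian through `x₀`. The
  -- truncated field is bounded and globally Lipschitz, so Picard–Lindelöf covers all of `[0,T]` at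
  -- once.
  let χ : ContDiffBump (0 : (κ → ℂ) × (κ → ℂ)) :=
    ⟨√(H x₀) + 1, √(H x₀) + 2, by positivity, by linarith⟩
  set g : (κ → ℂ) × (κ → ℂ) → (κ → ℂ) × (κ → ℂ) := fun x => χ x • galerkinField lam x with hg
  have hgsmooth : ContDiff ℝ 1 g := χ.contDiff.smul (contDiff_galerkinField lam)
  have hgsupp : HasCompactSupport g := χ.hasCompactSupport.smul_right
  obtain ⟨K, hK⟩ := hgsmooth.lipschitzWith_of_hasCompactSupport hgsupp one_ne_zero
  obtain ⟨L, hL⟩ := hgsupp.exists_bound_of_continuous hgsmooth.continuous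
  have hL0 : 0 ≤ L := (norm_nonneg _).trans (hL 0)
  have hPL : IsPicardLindelof (fun _ => g) (⟨0, le_rfl, hT.le⟩ : Icc 0 T) x₀
      (⟨L, hL0⟩ * ⟨T, hT.le⟩) 0 ⟨L, hL0⟩ K :=
    { lipschitzOnWith := fun _ _ => hK.lipschitzOnWith
      continuousOn := fun _ _ => continuousOn_const
      norm_le := fun _ _ x _ => hL x
      mul_max_le := by
        simp only [sub_zero, max_eq_left hT.le, sub_self, NNReal.coe_zero]
        exact le_rfl }
  obtain ⟨x, hx0, hx⟩ := hPL.exists_eq_forall_mem_Icc_hasDerivWithinAt₀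
  refine ⟨x, hx0, fun t ht => ?_⟩
  have d1 : ∀ t ∈ Icc 0 T, ∀ j, HasDerivWithinAt (fun t => (x t).1 j) (χ (x t) • (x t).2 j)
      (Icc 0 T) t := fun t ht j =>
    (hasDerivWithinAt_pi.1 ((hasFDerivAt_fst (𝕜 := ℝ)).comp_hasDerivWithinAt t (hx t ht))) j
  have d2 : ∀ t ∈ Icc 0 T, ∀ j, HasDerivWithinAt (fun t => (x t).2 j)
      (χ (x t) • (-((1 + N (x t)) * lam j ^ 2) • (x t).1 j)) (Icc 0 T) t := fun t ht j =>
    (hasDerivWithinAt_pi.1 ((hasFDerivAt_snd (𝕜 := ℝ)).comp_hasDerivWithinAt t (hx t ht))) j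
  -- The truncated field is a scalar multiple of the original one, so it is still tangent to the
  -- level sets of `H`. The orbit therefore never leaves the region where `χ = 1`.
  have dH : ∀ t ∈ Icc 0 T, HasDerivWithinAt (fun t => H (x t)) 0 (Icc 0 T) t := fun t ht => by
    have dN : HasDerivWithinAt (fun t => N (x t)) _ (Icc 0 T) t :=
      HasDerivWithinAt.fun_sum fun j _ => ((d1 t ht j).norm_sq.const_mul (lam j ^ 2))
    have dV : HasDerivWithinAt (fun t => ∑ k, ‖(x t).2 k‖ ^ 2) _ (Icc 0 T) t :=
      HasDerivWithinAt.fun_sum fun j _ => (d2 t ht j).norm_sq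
    refine (dV.add (dN.add ((dN.pow 2).div_const 2))).congr_deriv ?_
    have : ∀ j, 2 * inner ℝ ((x t).2 j) (χ (x t) • (-((1 + N (x t)) * lam j ^ 2) • (x t).1 j)) =
        -(1 + N (x t)) * (lam j ^ 2 * (2 * inner ℝ ((x t).1 j) (χ (x t) • (x t).2 j))) :=
      fun j => by
        simp only [inner_smul_right, real_inner_comm ((x t).2 j) ((x t).1 j)]; ring
    simp only [this, ← Finset.mul_sum]
    simp; ring
  have hHle : ∀ t ∈ Icc 0 T, H (x t) ≤ H x₀ := fun t ht => by
    have := antitoneOn_Icc_of_hasDerivWithinAt dH (fun _ _ => le_rfl) ⟨le_rfl, hT.le⟩ ht ht.1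
    simpa [hx0] using this
  have hχ : χ (x t) = 1 := χ.one_of_mem_closedBall (by
    rw [mem_closedBall_zero_iff]
    exact ((hnorm _).trans (Real.sqrt_le_sqrt (hHle t ht))).trans (by simp [χ]))
  have := hx t ht
  simpa [hg, hχ] using this

/-- Extension by zero keeps every index a mode of the same system, so approximations with different
`S` can be compared directly. -/
theorem exists_galerkin {ι : Type*} (S : Finset ι) {lam : ι → ℝ} (hlam : ∀ j, 1 ≤ lam j)
    {T : ℝ} (hT : 0 < T) (U₀ V₀ : ι → ℂ) :
    ∃ U V : ι → ℝ → ℂ, (∀ j ∈ S, U j 0 = U₀ j ∧ V j 0 = V₀ j) ∧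
      (∀ j ∉ S, ∀ t, U j t = 0 ∧ V j t = 0) ∧
      ∀ j, IsMode T (fun t => 1 + ∑ k ∈ S, lam k ^ 2 * ‖U k t‖ ^ 2) (lam j) (U j) (V j) := by
  classical
  obtain ⟨x, hx0, hx⟩ := exists_galerkin_fintype (lam := fun j : S => lam j) (fun j => hlam j) hT
    (fun j => U₀ j, fun j => V₀ j)
  refine ⟨fun j t => if h : j ∈ S then (x t).1 ⟨j, h⟩ else 0,
    fun j t => if h : j ∈ S then (x t).2 ⟨j, h⟩ else 0, fun j hj => ?_, fun j hj t => ?_,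
    fun j t ht => ?_⟩
  · simp [hj, hx0]
  · simp [hj]
  · by_cases hj : j ∈ S
    · have hsum : ∑ k ∈ S, lam k ^ 2 * ‖if h : k ∈ S then (x t).1 ⟨k, h⟩ else 0‖ ^ 2 =
          ∑ k : S, lam k ^ 2 * ‖(x t).1 k‖ ^ 2 := by
        rw [← Finset.sum_coe_sort S]
        exact Finset.sum_congr rfl fun k _ => by simp
      simp only [hj, dite_true, hsum]
      exact ⟨(hasDerivWithinAt_pi.1
          ((hasFDerivAt_fst (𝕜 := ℝ)).comp_hasDerivWithinAt t (hx t ht))) ⟨j, hj⟩,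
        (hasDerivWithinAt_pi.1
          ((hasFDerivAt_snd (𝕜 := ℝ)).comp_hasDerivWithinAt t (hx t ht))) ⟨j, hj⟩⟩
    · simp only [hj, dite_false, smul_zero]
      exact ⟨hasDerivWithinAt_const _ _ _, hasDerivWithinAt_const _ _ _⟩

/-! ## Comparison of two solutions -/

/-- `U` with `V = ∂_t U` is a family of modes solving the Kirchhoff equation on `[0,T]`, with
coefficient `a = 1 + ∑ lam² |U|²` and with `H^{3/2}` norm bounded by `√R`. -/
structure ModeSystem {ι : Type*} (lam : ι → ℝ) (T R : ℝ) (a : ℝ → ℝ) (U V : ι → ℝ → ℂ) :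
    Prop where
  mode : ∀ j, IsMode T a (lam j) (U j) (V j)
  cont : ContinuousOn a (Icc 0 T)
  hasSum : ∀ t ∈ Icc 0 T, HasSum (fun j => lam j ^ 2 * ‖U j t‖ ^ 2) (a t - 1)
  bound : ∀ t ∈ Icc 0 T, ∀ J : Finset ι, ∑ j ∈ J, lam j ^ 3 * ‖U j t‖ ^ 2 ≤ R

section Comparison

variable {ι : Type*} {lam : ι → ℝ} {T R : ℝ} {a a' : ℝ → ℝ} {U V U' V' : ι → ℝ → ℂ}

theorem ModeSystem.mono {R' : ℝ} (h : ModeSystem lam T R a U V) (hR : R ≤ R') :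
    ModeSystem lam T R' a U V :=
  ⟨h.mode, h.cont, h.hasSum, fun t ht J => (h.bound t ht J).trans hR⟩

theorem ModeSystem.one_le (h : ModeSystem lam T R a U V) {t : ℝ} (ht : t ∈ Icc 0 T) : 1 ≤ a t := by
  have := (h.hasSum t ht).nonneg fun j => by positivity
  linarith

/-- The difference of two quadratic `H¹` energies is controlled by the `H^{1/2}` norm of the
difference. -/
theorem sq_sub_le_of_hasSum (hlam : ∀ j, 1 ≤ lam j) {u u' : ι → ℂ} {A A' W : ℝ}
    (hA : HasSum (fun j => lam j ^ 2 * ‖u j‖ ^ 2) A)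
    (hA' : HasSum (fun j => lam j ^ 2 * ‖u' j‖ ^ 2) A')
    (hu : ∀ J : Finset ι, ∑ j ∈ J, lam j ^ 3 * ‖u j‖ ^ 2 ≤ R)
    (hu' : ∀ J : Finset ι, ∑ j ∈ J, lam j ^ 3 * ‖u' j‖ ^ 2 ≤ R)
    (hW : ∀ J : Finset ι, ∑ j ∈ J, lam j * ‖u j - u' j‖ ^ 2 ≤ W) :
    (A - A') ^ 2 ≤ 4 * R * W := by
  have hR : 0 ≤ R := by simpa using hu ∅
  have hlim : Tendsto (fun J : Finset ι =>
      (∑ j ∈ J, (lam j ^ 2 * ‖u j‖ ^ 2 - lam j ^ 2 * ‖u' j‖ ^ 2)) ^ 2) atTop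
      (𝓝 ((A - A') ^ 2)) := (hA.sub hA').pow 2
  refine le_of_tendsto hlim (Eventually.of_forall fun J => ?_)
  -- Cauchy–Schwarz with `λ² = λ^{1/2} · λ^{3/2}`: the half derivative goes to the difference and
  -- the rest to the sum, bounded in `H^{3/2}`.
  have h1 : |∑ j ∈ J, (lam j ^ 2 * ‖u j‖ ^ 2 - lam j ^ 2 * ‖u' j‖ ^ 2)| ≤
      ∑ j ∈ J, (√(lam j) * ‖u j - u' j‖) * (lam j * √(lam j) * (‖u j‖ + ‖u' j‖)) := by
    refine (Finset.abs_sum_le_sum_abs _ _).trans (Finset.sum_le_sum fun j _ => ?_)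
    have hl : 0 ≤ lam j := zero_le_one.trans (hlam j)
    have e1 : lam j ^ 2 * ‖u j‖ ^ 2 - lam j ^ 2 * ‖u' j‖ ^ 2 =
        lam j ^ 2 * (‖u j‖ - ‖u' j‖) * (‖u j‖ + ‖u' j‖) := by ring
    have e2 : (√(lam j) * ‖u j - u' j‖) * (lam j * √(lam j) * (‖u j‖ + ‖u' j‖)) =
        lam j ^ 2 * ‖u j - u' j‖ * (‖u j‖ + ‖u' j‖) := by
      have := Real.mul_self_sqrt hl
      linear_combination lam j * ‖u j - u' j‖ * (‖u j‖ + ‖u' j‖) * this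
    rw [e1, e2, abs_mul, abs_mul, abs_of_nonneg (sq_nonneg (lam j)),
      abs_of_nonneg (by positivity : 0 ≤ ‖u j‖ + ‖u' j‖)]
    gcongr
    exact abs_norm_sub_norm_le _ _
  have h2 := Finset.sum_mul_sq_le_sq_mul_sq J (fun j => √(lam j) * ‖u j - u' j‖)
    (fun j => lam j * √(lam j) * (‖u j‖ + ‖u' j‖))
  have h3 : ∑ j ∈ J, (√(lam j) * ‖u j - u' j‖) ^ 2 ≤ W := by
    refine (Finset.sum_congr rfl fun j _ => ?_).trans_le (hW J)
    rw [mul_pow, Real.sq_sqrt (zero_le_one.trans (hlam j))]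
  have h4 : ∑ j ∈ J, (lam j * √(lam j) * (‖u j‖ + ‖u' j‖)) ^ 2 ≤ 4 * R := by
    have : ∑ j ∈ J, (lam j * √(lam j) * (‖u j‖ + ‖u' j‖)) ^ 2 ≤
        ∑ j ∈ J, (2 * (lam j ^ 3 * ‖u j‖ ^ 2) + 2 * (lam j ^ 3 * ‖u' j‖ ^ 2)) := by
      refine Finset.sum_le_sum fun j _ => ?_
      have hl : 0 ≤ lam j := zero_le_one.trans (hlam j)
      rw [mul_pow, mul_pow, Real.sq_sqrt hl]
      nlinarith [mul_nonneg (pow_nonneg hl 3) (sq_nonneg (‖u j‖ - ‖u' j‖))]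
    rw [Finset.sum_add_distrib, ← Finset.mul_sum, ← Finset.mul_sum] at this
    linarith [hu J, hu' J]
  calc _ = |∑ j ∈ J, (lam j ^ 2 * ‖u j‖ ^ 2 - lam j ^ 2 * ‖u' j‖ ^ 2)| ^ 2 := (sq_abs _).symm
    _ ≤ _ := pow_le_pow_left₀ (abs_nonneg _) h1 2
    _ ≤ _ := h2
    _ ≤ W * (4 * R) := mul_le_mul h3 h4 (by positivity) (by simpa using hW ∅)
    _ = _ := by ring

/-- The constant in the stability estimate `ModeSystem.stability`. -/
noncomputable def stabilityConst (T R : ℝ) : ℝ :=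
  2 * Real.exp T * Real.exp (4 * R ^ 2 * Real.exp T * T)

/-- Two solutions stay close in `H^{1/2} × H^{-1/2}`. -/
theorem ModeSystem.stability (hlam : ∀ j, 1 ≤ lam j) {da : ℝ → ℝ}
    (h : ModeSystem lam T R a U V) (h' : ModeSystem lam T R a' U' V')
    (ha2 : ∀ t ∈ Icc 0 T, a t ≤ 2)
    (hda : ∀ t ∈ Icc 0 T, HasDerivWithinAt a (da t) (Icc 0 T) t)
    (hda1 : ∀ t ∈ Icc 0 T, |da t| ≤ 1) {θ : ℝ}
    (hinit : ∀ J : Finset ι,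
      ∑ j ∈ J, modeEnergy (lam j) (U j 0 - U' j 0) (V j 0 - V' j 0) ≤ θ)
    {t : ℝ} (ht : t ∈ Icc 0 T) :
    (∀ J : Finset ι, ∑ j ∈ J, modeEnergy (lam j) (U j t - U' j t) (V j t - V' j t) ≤
      stabilityConst T R * θ) ∧
    (a t - a' t) ^ 2 ≤ 4 * R * (stabilityConst T R * θ) := by
  have hT : 0 ≤ T := ht.1.trans ht.2
  have h0 : (0 : ℝ) ∈ Icc 0 T := ⟨le_rfl, hT⟩
  have hR : 0 ≤ R := by simpa using h.bound t ht ∅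
  have hθ : 0 ≤ θ := by simpa using hinit ∅
  -- The energy of finitely many modes does not control `a - a'`, which involves all of them. The
  -- argument is closed through `Y = ∫ (a - a')²`, which does not depend on `J`.
  obtain ⟨Y, hY0, hY⟩ := exists_antideriv_Icc hT ((h.cont.sub h'.cont).pow 2)
  -- The energy carries the coefficient `a` of the first system only, so `a'` need not be
  -- differentiable. This allows an arbitrary solution in second place.
  set Q : Finset ι → ℝ → ℝ := fun J t => ∑ j ∈ J, (a t * lam j * ‖U j t - U' j t‖ ^ 2 +
    ‖V j t - V' j t‖ ^ 2 / lam j) with hQ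
  have hEQ : ∀ J, ∀ t ∈ Icc 0 T,
      ∑ j ∈ J, modeEnergy (lam j) (U j t - U' j t) (V j t - V' j t) ≤ Q J t := fun J t ht =>
    Finset.sum_le_sum fun j _ => by
      unfold modeEnergy
      gcongr
      have := hlam j
      nlinarith [h.one_le ht]
  have hQ0 : ∀ J, Q J 0 ≤ 2 * θ := fun J => by
    refine le_trans ?_ (mul_le_mul_of_nonneg_left (hinit J) zero_le_two)
    rw [Finset.mul_sum]
    refine Finset.sum_le_sum fun j _ => ?_
    have hl := hlam j
    have h1 : 0 ≤ ‖V j 0 - V' j 0‖ ^ 2 / lam j := by positivity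
    have h2 : 0 ≤ lam j * ‖U j 0 - U' j 0‖ ^ 2 := by positivity
    unfold modeEnergy
    nlinarith [ha2 0 h0]
  have hQY : ∀ J, ∀ t ∈ Icc 0 T, Q J t ≤ Real.exp T * (2 * θ + R * Y t) := by
    intro J t ht
    have dQ : ∀ t ∈ Icc 0 T, HasDerivWithinAt (Q J) (∑ j ∈ J,
        (da t * lam j * ‖U j t - U' j t‖ ^ 2 -
          2 * (a t - a' t) * lam j * inner ℝ (V j t - V' j t) (U' j t))) (Icc 0 T) t := by
      intro t ht
      refine HasDerivWithinAt.fun_sum fun j _ => ?_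
      have hl : lam j ≠ 0 := (zero_lt_one.trans_le (hlam j)).ne'
      have dw := (h.mode j t ht).1.sub (h'.mode j t ht).1
      have dv := (h.mode j t ht).2.sub (h'.mode j t ht).2
      refine ((((hda t ht).mul_const (lam j)).mul dw.norm_sq).add
        (dv.norm_sq.div_const (lam j))).congr_deriv ?_
      have e1 : -(a t * lam j ^ 2) • U j t - -(a' t * lam j ^ 2) • U' j t =
          -(a t * lam j ^ 2) • (U j t - U' j t) - ((a t - a' t) * lam j ^ 2) • U' j t := by
        module
      have e2 : inner ℝ (V j t - V' j t)
          (-(a t * lam j ^ 2) • (U j t - U' j t) - ((a t - a' t) * lam j ^ 2) • U' j t) =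
          -(a t * lam j ^ 2) * inner ℝ (V j t - V' j t) (U j t - U' j t) -
          (a t - a' t) * lam j ^ 2 * inner ℝ (V j t - V' j t) (U' j t) := by
        rw [inner_sub_right, inner_smul_right, inner_smul_right]
      simp only [Pi.sub_apply]
      rw [e1, e2, real_inner_comm (U j t - U' j t) (V j t - V' j t)]
      field_simp
      ring
    have hexpmono : Real.exp (1 * t) * (Q J 0 + R * Y t) ≤ Real.exp T * (2 * θ + R * Y t) := by
      have hYnn : 0 ≤ Y t := by
        have := antitoneOn_Icc_of_hasDerivWithinAt (fun s hs => (hY s hs).neg)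
          (fun s _ => neg_nonpos.2 (sq_nonneg _)) h0 ht ht.1
        simp only [Pi.neg_apply, hY0] at this
        linarith
      have h1 : Q J 0 + R * Y t ≤ 2 * θ + R * Y t := by linarith [hQ0 J]
      refine (mul_le_mul_of_nonneg_left h1 (Real.exp_pos _).le).trans ?_
      rw [one_mul]
      gcongr
      exact ht.2
    refine (le_exp_mul_add_of_deriv_le zero_le_one hR dQ hY hY0 (fun s _ => sq_nonneg _)
      (fun s hs => ?_) ht).trans hexpmono
    have h1 : ∀ j ∈ J, da s * lam j * ‖U j s - U' j s‖ ^ 2 -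
        2 * (a s - a' s) * lam j * inner ℝ (V j s - V' j s) (U' j s) ≤
        (a s * lam j * ‖U j s - U' j s‖ ^ 2 + ‖V j s - V' j s‖ ^ 2 / lam j) +
          (a s - a' s) ^ 2 * (lam j ^ 3 * ‖U' j s‖ ^ 2) := by
      intro j _
      have hl : 0 < lam j := zero_lt_one.trans_le (hlam j)
      have i1 : da s * lam j * ‖U j s - U' j s‖ ^ 2 ≤ a s * lam j * ‖U j s - U' j s‖ ^ 2 := by
        gcongr
        exact ((abs_le.1 (hda1 s hs)).2).trans (h.one_le hs)
      have i2 : -(2 * (a s - a' s) * lam j * inner ℝ (V j s - V' j s) (U' j s)) ≤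
          ‖V j s - V' j s‖ ^ 2 / lam j + (a s - a' s) ^ 2 * (lam j ^ 3 * ‖U' j s‖ ^ 2) := by
        have i3 : inner ℝ (V j s - V' j s) (((a s - a' s) * lam j ^ 2) • U' j s) =
            (a s - a' s) * lam j ^ 2 * inner ℝ (V j s - V' j s) (U' j s) := inner_smul_right _ _ _
        have i4 := norm_add_sq_real (V j s - V' j s) (((a s - a' s) * lam j ^ 2) • U' j s)
        rw [i3, norm_smul, mul_pow, Real.norm_eq_abs, sq_abs] at i4
        have i5 : 0 ≤ ‖V j s - V' j s + ((a s - a' s) * lam j ^ 2) • U' j s‖ ^ 2 / lam j := by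
          positivity
        rw [i4] at i5
        have i6 : (‖V j s - V' j s‖ ^ 2 +
            2 * ((a s - a' s) * lam j ^ 2 * inner ℝ (V j s - V' j s) (U' j s)) +
            ((a s - a' s) * lam j ^ 2) ^ 2 * ‖U' j s‖ ^ 2) / lam j =
            ‖V j s - V' j s‖ ^ 2 / lam j + (a s - a' s) ^ 2 * (lam j ^ 3 * ‖U' j s‖ ^ 2) +
            2 * (a s - a' s) * lam j * inner ℝ (V j s - V' j s) (U' j s) := by
          field_simp; ring
        rw [i6] at i5
        linarith
      linarith
    refine (Finset.sum_le_sum h1).trans ?_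
    rw [Finset.sum_add_distrib, ← Finset.mul_sum, one_mul]
    have h2 := mul_le_mul_of_nonneg_left (h'.bound s hs J) (sq_nonneg (a s - a' s))
    change Q J s + _ ≤ Q J s + R * (a s - a' s) ^ 2
    linarith
  have hφ : ∀ t ∈ Icc 0 T, (a t - a' t) ^ 2 ≤ 4 * R * (Real.exp T * (2 * θ + R * Y t)) := by
    intro t ht
    have := sq_sub_le_of_hasSum hlam (h.hasSum t ht) (h'.hasSum t ht) (h.bound t ht)
      (h'.bound t ht) (fun J => (Finset.sum_le_sum fun j _ => ?_).trans
        ((hEQ J t ht).trans (hQY J t ht)))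
    · simpa using this
    · have := hlam j
      unfold modeEnergy
      have h1 : 0 ≤ ‖V j t - V' j t‖ ^ 2 / lam j := by positivity
      linarith
  -- Second use of Gronwall: `2θ + R Y` has derivative `R (a - a')²`, which by `hφ` is at most `4R²
  -- e^T` times itself.
  have hY' : 2 * θ + R * Y t ≤ Real.exp (4 * R ^ 2 * Real.exp T * T) * (2 * θ) := by
    have h1 := le_exp_mul_of_deriv_le (K := 4 * R ^ 2 * Real.exp T)
      (fun s hs => ((hY s hs).const_mul R).const_add (2 * θ)) (fun s hs => by
        have := mul_le_mul_of_nonneg_left (hφ s hs) hR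
        change R * (a s - a' s) ^ 2 ≤ _
        nlinarith) ht
    refine h1.trans ?_
    simp only [hY0, mul_zero, add_zero]
    gcongr
    exact ht.2
  have hfin : Real.exp T * (2 * θ + R * Y t) ≤ stabilityConst T R * θ := by
    have := mul_le_mul_of_nonneg_left hY' (Real.exp_pos T).le
    unfold stabilityConst
    linarith
  refine ⟨fun J => (hEQ J t ht).trans ((hQY J t ht).trans hfin), (hφ t ht).trans ?_⟩
  gcongr

end Comparison

/-! ## The limit of the Galerkin approximations -/

theorem exists_tendstoUniformlyOn_of_sq_le {ι E : Type*} [NormedAddCommGroup E] [CompleteSpace E]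
    {s : Set ℝ} {F : Finset ι → ℝ → E} {θ : Finset ι → ℝ} {c : ℝ}
    (hθ : Tendsto θ atTop (𝓝 0))
    (hF : ∀ S₀ S S' : Finset ι, S₀ ⊆ S → S₀ ⊆ S' → ∀ t ∈ s, ‖F S t - F S' t‖ ^ 2 ≤ c * θ S₀) :
    ∃ f : ℝ → E, TendstoUniformlyOn F f atTop s := by
  classical
  have hc : UniformCauchySeqOn F atTop s := by
    rw [Metric.uniformCauchySeqOn_iff]
    intro ε hε
    have h1 : Tendsto (fun S => c * θ S) atTop (𝓝 0) := by simpa using hθ.const_mul c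
    obtain ⟨S₀, hS₀⟩ := (h1.eventually_lt_const (pow_pos hε 2)).exists
    refine ⟨S₀, fun S hS S' hS' t ht => ?_⟩
    rw [dist_eq_norm]
    exact lt_of_pow_lt_pow_left₀ 2 hε.le ((hF S₀ S S' hS hS' t ht).trans_lt hS₀)
  have hlim : ∀ t, ∃ y, t ∈ s → Tendsto (fun S => F S t) atTop (𝓝 y) := fun t => by
    by_cases ht : t ∈ s
    · obtain ⟨y, hy⟩ := CompleteSpace.complete (hc.cauchy_map ht)
      exact ⟨y, fun _ => hy⟩
    · exact ⟨0, fun h => absurd h ht⟩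
  choose f hf using hlim
  exact ⟨f, hc.tendstoUniformlyOn_of_tendsto fun t ht => hf t ht⟩

/-- As `|a'| ≤ 1 ≤ a`, the energy with coefficient `a` satisfies Gronwall with rate one. The
constant depends on `T`, but it holds for each single mode and so supplies a majorant for dominated
convergence; the bounds uniform in `T` come from the weighted energies. -/
theorem IsMode.modeEnergy_le {T l : ℝ} (hl : 1 ≤ l) {a da : ℝ → ℝ} {u v : ℝ → ℂ}
    (h : IsMode T a l u v) (ha1 : ∀ t ∈ Icc 0 T, 1 ≤ a t) (ha2 : ∀ t ∈ Icc 0 T, a t ≤ 2)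
    (hda : ∀ t ∈ Icc 0 T, HasDerivWithinAt a (da t) (Icc 0 T) t)
    (hda1 : ∀ t ∈ Icc 0 T, |da t| ≤ 1) {t : ℝ} (ht : t ∈ Icc 0 T) :
    modeEnergy l (u t) (v t) ≤ 2 * Real.exp T * modeEnergy l (u 0) (v 0) := by
  have hl0 : 0 < l := zero_lt_one.trans_le hl
  have h0 : (0 : ℝ) ∈ Icc 0 T := ⟨le_rfl, ht.1.trans ht.2⟩
  have d : ∀ t ∈ Icc 0 T, HasDerivWithinAt (fun t => a t * l * ‖u t‖ ^ 2 + ‖v t‖ ^ 2 / l)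
      (da t * l * ‖u t‖ ^ 2) (Icc 0 T) t := fun t ht => by
    refine ((((hda t ht).mul_const l).mul (h t ht).1.norm_sq).add
      ((h t ht).2.norm_sq.div_const l)).congr_deriv ?_
    have e : inner ℝ (v t) (-(a t * l ^ 2) • u t) = -(a t * l ^ 2) * inner ℝ (u t) (v t) := by
      rw [inner_smul_right, real_inner_comm]
    rw [e]
    field_simp
    ring
  have hg := le_exp_mul_of_deriv_le (K := 1) d (fun t ht => by
    have h1 : da t * (l * ‖u t‖ ^ 2) ≤ a t * (l * ‖u t‖ ^ 2) :=
      mul_le_mul_of_nonneg_right ((abs_le.1 (hda1 t ht)).2.trans (ha1 t ht)) (by positivity)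
    have h2 : 0 ≤ ‖v t‖ ^ 2 / l := by positivity
    linarith) ht
  have hlow : modeEnergy l (u t) (v t) ≤ a t * l * ‖u t‖ ^ 2 + ‖v t‖ ^ 2 / l := by
    unfold modeEnergy
    gcongr
    nlinarith [ha1 t ht]
  have hup : a 0 * l * ‖u 0‖ ^ 2 + ‖v 0‖ ^ 2 / l ≤ 2 * modeEnergy l (u 0) (v 0) := by
    unfold modeEnergy
    have h1 : 0 ≤ ‖v 0‖ ^ 2 / l := by positivity
    have h2 : 0 ≤ l * ‖u 0‖ ^ 2 := by positivity
    nlinarith [ha2 0 h0]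
  have hexp : Real.exp (1 * t) ≤ Real.exp T := Real.exp_le_exp.2 (by linarith [ht.2])
  calc _ ≤ _ := hlow.trans hg
    _ ≤ Real.exp T * (2 * modeEnergy l (u 0) (v 0)) := by
        refine mul_le_mul hexp hup ?_ (Real.exp_pos _).le
        have := ha1 0 h0
        positivity
    _ = _ := by ring

/-- The solution with modes in the finite set `S`, and its bounds. -/
structure IsGalerkin {ι : Type*} (lam : ι → ℝ) (T : ℝ) (U₀ V₀ : ι → ℂ) (S : Finset ι)
    (a : ℝ → ℝ) (U V : ι → ℝ → ℂ) : Prop where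
  system : ModeSystem lam T 1 a U V
  le_two : ∀ t ∈ Icc 0 T, a t ≤ 2
  exists_deriv : ∃ da : ℝ → ℝ, (∀ t ∈ Icc 0 T, HasDerivWithinAt a (da t) (Icc 0 T) t) ∧
    ∀ t ∈ Icc 0 T, |da t| ≤ 1
  init : ∀ j ∈ S, U j 0 = U₀ j ∧ V j 0 = V₀ j
  zero : ∀ j ∉ S, ∀ t, U j t = 0 ∧ V j t = 0
  weighted : ∀ w : ℝ → ℝ, (∀ x, 0 ≤ w x) → ∀ W, (∀ J : Finset ι,
    ∑ j ∈ J, w (lam j) * modeEnergy (lam j) (U₀ j) (V₀ j) ≤ W) → ∀ t ∈ Icc 0 T, ∀ J : Finset ι,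
    ∑ j ∈ J, w (lam j) * modeEnergy (lam j) (U j t) (V j t) ≤ 36 * W
  mode_le : ∀ t ∈ Icc 0 T, ∀ j, modeEnergy (lam j) (U j t) (V j t) ≤
    2 * Real.exp T * modeEnergy (lam j) (U₀ j) (V₀ j)

section Limit

variable {ι : Type*} {lam : ι → ℝ} {r : ℝ → ℝ} {T η : ℝ} {U₀ V₀ : ι → ℂ}

theorem exists_isGalerkin (hlam : ∀ j, 1 ≤ lam j) (hr : ∀ j, 1 ≤ r (lam j))
    (hgap : ∀ j k, |lam j - lam k|⁻¹ ≤ 3 * r (lam j))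
    (hη0 : 0 < η) (hη : η ≤ 1 / 100) (hT0 : 0 < T) (hT : T * η ^ 2 ≤ 1 / 1600)
    (hinit : ∀ J : Finset ι,
      ∑ j ∈ J, lam j ^ 2 * r (lam j) * modeEnergy (lam j) (U₀ j) (V₀ j) ≤ η) (S : Finset ι) :
    ∃ a U V, IsGalerkin lam T U₀ V₀ S a U V := by
  classical
  obtain ⟨U, V, hi, hz, hm⟩ := exists_galerkin S hlam hT0 U₀ V₀
  set a : ℝ → ℝ := fun t => 1 + ∑ k ∈ S, lam k ^ 2 * ‖U k t‖ ^ 2 with ha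
  have ha1 : ∀ t ∈ Icc 0 T, 1 ≤ a t := fun t _ => by
    rw [ha, le_add_iff_nonneg_right]; positivity
  have hw : ∀ w : ℝ → ℝ, (∀ x, 0 ≤ w x) → ∀ W, (∀ J : Finset ι,
      ∑ j ∈ J, w (lam j) * modeEnergy (lam j) (U₀ j) (V₀ j) ≤ W) → ∀ t ∈ Icc 0 T,
      ∀ J : Finset ι, ∑ j ∈ J, w (lam j) * modeEnergy (lam j) (U j t) (V j t) ≤ 36 * W := by
    intro w hw W hW t ht J
    have hinitS : ∀ w : ι → ℝ, ∑ j ∈ S, w j * modeEnergy (lam j) (U j 0) (V j 0) =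
        ∑ j ∈ S, w j * modeEnergy (lam j) (U₀ j) (V₀ j) := fun w =>
      Finset.sum_congr rfl fun j hj => by rw [(hi j hj).1, (hi j hj).2]
    have h1 := weighted_energy_le (r := r) (a := a) (fun j _ => hm j) (fun _ _ => rfl)
      (fun j _ => hlam j) (fun j _ => hr j) (fun j _ k _ => hgap j k) hη0 hη hT
      ((hinitS _).trans_le (hinit S)) hw ht
    rw [hinitS] at h1
    have h2 : ∑ j ∈ J, w (lam j) * modeEnergy (lam j) (U j t) (V j t) ≤
        ∑ j ∈ S, w (lam j) * modeEnergy (lam j) (U j t) (V j t) := by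
      rw [Finset.sum_subset (Finset.subset_union_right (s₁ := J) (s₂ := S))]
      · exact Finset.sum_le_sum_of_subset_of_nonneg Finset.subset_union_left fun j _ _ =>
          mul_nonneg (hw _) (modeEnergy_nonneg (hlam j) _ _)
      · intro j _ hj
        simp [hz j hj t, modeEnergy]
    linarith [hW S]
  have hbd : ∀ t ∈ Icc 0 T, ∀ J : Finset ι,
      ∑ j ∈ J, lam j ^ 2 * modeEnergy (lam j) (U j t) (V j t) ≤ 1 := fun t ht J => by
    -- Here `36η ≤ 36/100 < 1`, which gives the radius `R = 1` of the system.
    have h1 := hw (fun x => x ^ 2 * max (r x) 0) (fun x => by positivity) η (fun J => by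
      simpa only [max_eq_left (zero_le_one.trans (hr _))] using hinit J) t ht J
    refine (Finset.sum_le_sum fun j _ => ?_).trans (h1.trans (by linarith))
    simp only [max_eq_left (zero_le_one.trans (hr j))]
    have h2 := modeEnergy_nonneg (hlam j) (U j t) (V j t)
    have h3 := hr j
    refine mul_le_mul_of_nonneg_right ?_ h2
    nlinarith [sq_nonneg (lam j)]
  have hbU : ∀ t ∈ Icc 0 T, ∀ J : Finset ι, ∑ j ∈ J, lam j ^ 3 * ‖U j t‖ ^ 2 ≤ 1 :=
    fun t ht J => (Finset.sum_le_sum fun j _ => by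
      have h1 : 0 ≤ lam j ^ 2 * (‖V j t‖ ^ 2 / lam j) := by have := hlam j; positivity
      unfold modeEnergy
      linarith).trans (hbd t ht J)
  have ha2 : ∀ t ∈ Icc 0 T, a t ≤ 2 := fun t ht => by
    have := (Finset.sum_le_sum fun j (_ : j ∈ S) => by
      have h1 := pow_le_pow_right₀ (hlam j) (by norm_num : 2 ≤ 3)
      exact mul_le_mul_of_nonneg_right h1 (sq_nonneg ‖U j t‖)).trans (hbU t ht S)
    simp only [ha]; linarith
  have hda : ∀ t ∈ Icc 0 T, HasDerivWithinAt a _ (Icc 0 T) t := fun t ht =>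
    hasDerivWithinAt_coefficient (fun j _ => hm j) (fun _ _ => rfl) ht
  have hda1 : ∀ t ∈ Icc 0 T, |∑ j ∈ S, lam j ^ 2 * (2 * inner ℝ (U j t) (V j t))| ≤ 1 :=
    fun t ht => by
    refine (Finset.abs_sum_le_sum_abs _ _).trans
      ((Finset.sum_le_sum fun j _ => ?_).trans (hbd t ht S))
    rw [abs_mul, abs_of_nonneg (sq_nonneg (lam j))]
    have := two_mul_abs_inner_le (zero_lt_one.trans_le (hlam j)) (U j t) (V j t)
    gcongr
  refine ⟨a, U, V, ⟨hm, fun t ht => (hda t ht).continuousWithinAt, fun t _ => ?_, hbU⟩, ha2,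
    ⟨_, hda, hda1⟩, hi, hz, hw, fun t ht j => ?_⟩
  · simp only [ha, add_sub_cancel_left]
    exact hasSum_sum_of_ne_finset_zero fun j hj => by simp [hz j hj t]
  · by_cases hj : j ∈ S
    · have := (hm j).modeEnergy_le (hlam j) ha1 ha2 hda hda1 ht
      rwa [(hi j hj).1, (hi j hj).2] at this
    · rw [(hz j hj t).1, (hz j hj t).2]
      have := modeEnergy_nonneg (hlam j) (U₀ j) (V₀ j)
      simp only [modeEnergy, norm_zero] at *
      simp only [ne_eq, OfNat.ofNat_ne_zero, not_false_eq_true, zero_pow, mul_zero, zero_div,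
        add_zero]
      positivity

/-- Agreement on `S` leaves only modes outside `S`, so the difference is bounded by a tail of the
data. Applied at time zero, it supplies the small parameter of the stability estimate. -/
theorem sum_modeEnergy_sub_le (hlam : ∀ j, 1 ≤ lam j)
    (hsum : Summable fun j => modeEnergy (lam j) (U₀ j) (V₀ j)) {u u' v v' : ι → ℂ} {S : Finset ι}
    (hS : ∀ j ∈ S, u j = u' j ∧ v j = v' j)
    (hle : ∀ j, modeEnergy (lam j) (u j - u' j) (v j - v' j) ≤
      modeEnergy (lam j) (U₀ j) (V₀ j)) (J : Finset ι) :
    ∑ j ∈ J, modeEnergy (lam j) (u j - u' j) (v j - v' j) ≤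
      ∑' j, modeEnergy (lam j) (U₀ j) (V₀ j) - ∑ j ∈ S, modeEnergy (lam j) (U₀ j) (V₀ j) := by
  classical
  have h1 : ∑ j ∈ J, modeEnergy (lam j) (u j - u' j) (v j - v' j) ≤
      ∑ j ∈ J \ S, modeEnergy (lam j) (U₀ j) (V₀ j) := by
    rw [← Finset.sum_subset (Finset.sdiff_subset (s := J) (t := S))]
    · exact Finset.sum_le_sum fun j _ => hle j
    · intro j hj hjS
      have hjS : j ∈ S := by
        by_contra h
        exact hjS (Finset.mem_sdiff.2 ⟨hj, h⟩)
      simp [hS j hjS, modeEnergy]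
  have h2 := hsum.sum_le_tsum ((J \ S) ∪ S) fun j _ => modeEnergy_nonneg (hlam j) _ _
  rw [Finset.sum_union Finset.sdiff_disjoint] at h2
  linarith

theorem IsGalerkin.modeEnergy_sub_init_le {S S' : Finset ι} {a a' : ℝ → ℝ}
    {U V U' V' : ι → ℝ → ℂ} (hlam : ∀ j, 1 ≤ lam j) (h : IsGalerkin lam T U₀ V₀ S a U V)
    (h' : IsGalerkin lam T U₀ V₀ S' a' U' V') (j : ι) :
    modeEnergy (lam j) (U j 0 - U' j 0) (V j 0 - V' j 0) ≤
      modeEnergy (lam j) (U₀ j) (V₀ j) := by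
  have hnn := modeEnergy_nonneg (hlam j) (U₀ j) (V₀ j)
  by_cases hj : j ∈ S <;> by_cases hj' : j ∈ S'
  · rw [(h.init j hj).1, (h.init j hj).2, (h'.init j hj').1, (h'.init j hj').2]
    simpa [modeEnergy] using hnn
  · rw [(h.init j hj).1, (h.init j hj).2, (h'.zero j hj' 0).1, (h'.zero j hj' 0).2]
    simp
  · rw [(h.zero j hj 0).1, (h.zero j hj 0).2, (h'.init j hj').1, (h'.init j hj').2]
    simp [modeEnergy]
  · rw [(h.zero j hj 0).1, (h.zero j hj 0).2, (h'.zero j hj' 0).1, (h'.zero j hj' 0).2]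
    simpa [modeEnergy] using hnn

theorem norm_sq_le_of_modeEnergy_le {l c : ℝ} {u v : ℂ} (hl : 1 ≤ l) (h : modeEnergy l u v ≤ c) :
    ‖u‖ ^ 2 ≤ c ∧ ‖v‖ ^ 2 ≤ l * c := by
  have hl0 : 0 < l := zero_lt_one.trans_le hl
  have h1 : 0 ≤ ‖v‖ ^ 2 / l := by positivity
  have h2 : 0 ≤ l * ‖u‖ ^ 2 := by positivity
  have h3 : ‖u‖ ^ 2 ≤ l * ‖u‖ ^ 2 := le_mul_of_one_le_left (sq_nonneg _) hl
  unfold modeEnergy at h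
  refine ⟨by linarith, ?_⟩
  have : ‖v‖ ^ 2 / l ≤ c := by linarith
  rwa [div_le_iff₀' hl0] at this

/-- Existence, uniqueness and bounds for small data, mode by mode. -/
theorem exists_modeSystem (hlam : ∀ j, 1 ≤ lam j) (hr : ∀ j, 1 ≤ r (lam j))
    (hgap : ∀ j k, |lam j - lam k|⁻¹ ≤ 3 * r (lam j))
    (hη0 : 0 < η) (hη : η ≤ 1 / 100) (hT0 : 0 < T) (hT : T * η ^ 2 ≤ 1 / 1600)
    (hinit : ∀ J : Finset ι,
      ∑ j ∈ J, lam j ^ 2 * r (lam j) * modeEnergy (lam j) (U₀ j) (V₀ j) ≤ η) :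
    ∃ a U V, ModeSystem lam T 1 a U V ∧ (∀ j, U j 0 = U₀ j ∧ V j 0 = V₀ j) ∧
      (∀ w : ℝ → ℝ, (∀ x, 0 ≤ w x) → ∀ W, (∀ J : Finset ι,
        ∑ j ∈ J, w (lam j) * modeEnergy (lam j) (U₀ j) (V₀ j) ≤ W) → ∀ t ∈ Icc 0 T,
        ∀ J : Finset ι, ∑ j ∈ J, w (lam j) * modeEnergy (lam j) (U j t) (V j t) ≤ 36 * W) ∧
      (∀ t ∈ Icc 0 T, ∀ j, modeEnergy (lam j) (U j t) (V j t) ≤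
        2 * Real.exp T * modeEnergy (lam j) (U₀ j) (V₀ j)) ∧
      ∀ R a' U' V', ModeSystem lam T R a' U' V' → (∀ j, U' j 0 = U₀ j ∧ V' j 0 = V₀ j) →
        ∀ t ∈ Icc 0 T, ∀ j, U' j t = U j t := by
  classical
  choose a U V h using exists_isGalerkin (U₀ := U₀) (V₀ := V₀) hlam hr hgap hη0 hη hT0 hT hinit
  set e₀ : ι → ℝ := fun j => modeEnergy (lam j) (U₀ j) (V₀ j) with he₀
  have he0 : ∀ j, 0 ≤ e₀ j := fun j => modeEnergy_nonneg (hlam j) _ _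
  have hsum2 : Summable fun j => lam j ^ 2 * r (lam j) * e₀ j :=
    summable_of_sum_le (fun j => by
      have := he0 j
      have := hr j
      positivity) hinit
  have hl2 : ∀ j, lam j ≤ lam j ^ 2 * r (lam j) := fun j => by
    have h1 := hlam j
    have h2 := hr j
    nlinarith [mul_nonneg (sq_nonneg (lam j)) (sub_nonneg.2 h2)]
  have hsum1 : Summable fun j => lam j * e₀ j :=
    hsum2.of_nonneg_of_le (fun j => mul_nonneg (zero_le_one.trans (hlam j)) (he0 j)) fun j =>
      mul_le_mul_of_nonneg_right (hl2 j) (he0 j)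
  have hsum0 : Summable e₀ := hsum1.of_nonneg_of_le he0 fun j =>
    le_mul_of_one_le_left (he0 j) (hlam j)
  set θ : Finset ι → ℝ := fun S => ∑' j, e₀ j - ∑ j ∈ S, e₀ j with hθ
  have hθ0 : Tendsto θ atTop (𝓝 0) := by
    have := (tendsto_const_nhds (x := ∑' j, e₀ j)).sub hsum0.hasSum
    simpa using this
  have hstab : ∀ S₀ S S' : Finset ι, S₀ ⊆ S → S₀ ⊆ S' → ∀ t ∈ Icc 0 T,
      (∀ j, modeEnergy (lam j) (U S j t - U S' j t) (V S j t - V S' j t) ≤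
        stabilityConst T 1 * θ S₀) ∧
      (a S t - a S' t) ^ 2 ≤ 4 * (stabilityConst T 1 * θ S₀) := by
    intro S₀ S S' hS hS' t ht
    obtain ⟨da, hda, hda1⟩ := (h S).exists_deriv
    have := (h S).system.stability hlam (h S').system (h S).le_two hda hda1 (θ := θ S₀)
      (sum_modeEnergy_sub_le hlam hsum0 (fun j hj => by
        simp [(h S).init j (hS hj), (h S').init j (hS' hj)])
        ((h S).modeEnergy_sub_init_le hlam (h S'))) ht
    exact ⟨fun j => by simpa using this.1 {j}, by simpa using this.2⟩
  have hnorm : ∀ S₀ S S' : Finset ι, S₀ ⊆ S → S₀ ⊆ S' → ∀ t ∈ Icc 0 T, ∀ j,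
      ‖U S j t - U S' j t‖ ^ 2 ≤ stabilityConst T 1 * θ S₀ ∧
      ‖V S j t - V S' j t‖ ^ 2 ≤ lam j * (stabilityConst T 1 * θ S₀) :=
    fun S₀ S S' hS hS' t ht j =>
      norm_sq_le_of_modeEnergy_le (hlam j) ((hstab S₀ S S' hS hS' t ht).1 j)
  obtain ⟨α, hα⟩ := exists_tendstoUniformlyOn_of_sq_le (F := a) (s := Icc 0 T)
    (c := 4 * stabilityConst T 1) hθ0 fun S₀ S S' hS hS' t ht => by
      rw [Real.norm_eq_abs, sq_abs, mul_assoc]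
      exact (hstab S₀ S S' hS hS' t ht).2
  have hUex : ∀ j, ∃ f, TendstoUniformlyOn (fun S => U S j) f atTop (Icc 0 T) := fun j =>
    exists_tendstoUniformlyOn_of_sq_le (c := stabilityConst T 1) hθ0
      fun S₀ S S' hS hS' t ht => (hnorm S₀ S S' hS hS' t ht j).1
  have hVex : ∀ j, ∃ f, TendstoUniformlyOn (fun S => V S j) f atTop (Icc 0 T) := fun j =>
    exists_tendstoUniformlyOn_of_sq_le (c := lam j * stabilityConst T 1) hθ0
      fun S₀ S S' hS hS' t ht => by
        rw [mul_assoc]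
        exact (hnorm S₀ S S' hS hS' t ht j).2
  choose u hu using hUex
  choose v hv using hVex
  have hUle : ∀ S, ∀ t ∈ Icc 0 T, ∀ j, ‖U S j t‖ ^ 2 ≤ 1 := fun S t ht j => by
    have h1 := (h S).system.bound t ht {j}
    rw [Finset.sum_singleton] at h1
    exact (le_mul_of_one_le_left (sq_nonneg _) (one_le_pow₀ (hlam j))).trans h1
  -- The right sides of the equations for `V` must converge uniformly as well. The constant `16`
  -- comes from `(x + y)² ≤ 2x² + 2y²` with both squares at most `4 · stabilityConst · θ`.
  have hGex : ∀ j, ∃ f, TendstoUniformlyOn (fun S t => -(a S t * lam j ^ 2) • U S j t) f atTop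
      (Icc 0 T) := fun j =>
    exists_tendstoUniformlyOn_of_sq_le (c := (lam j ^ 2) ^ 2 * 16 * stabilityConst T 1) hθ0
      fun S₀ S S' hS hS' t ht => by
        have e : -(a S t * lam j ^ 2) • U S j t - -(a S' t * lam j ^ 2) • U S' j t =
            (-(lam j ^ 2)) • (a S t • (U S j t - U S' j t) + (a S t - a S' t) • U S' j t) := by
          module
        rw [e, norm_smul, mul_pow, Real.norm_eq_abs, sq_abs, neg_sq, mul_assoc, mul_assoc]
        refine mul_le_mul_of_nonneg_left ?_ (by positivity)
        have h1 := norm_add_le (a S t • (U S j t - U S' j t)) ((a S t - a S' t) • U S' j t)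
        have h2 : ‖a S t • (U S j t - U S' j t)‖ ^ 2 ≤ 4 * (stabilityConst T 1 * θ S₀) := by
          rw [norm_smul, mul_pow, Real.norm_eq_abs, sq_abs]
          have h3 := (h S).system.one_le ht
          have h4 : a S t ^ 2 ≤ 4 := by nlinarith [(h S).le_two t ht]
          exact mul_le_mul h4 (hnorm S₀ S S' hS hS' t ht j).1 (by positivity) (by norm_num)
        have h5 : ‖(a S t - a S' t) • U S' j t‖ ^ 2 ≤ 4 * (stabilityConst T 1 * θ S₀) := by
          rw [norm_smul, mul_pow, Real.norm_eq_abs, sq_abs]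
          have := mul_le_mul (hstab S₀ S S' hS hS' t ht).2 (hUle S' t ht j) (by positivity)
            ((sq_nonneg _).trans (hstab S₀ S S' hS hS' t ht).2)
          simpa using this
        have h6 := pow_le_pow_left₀ (norm_nonneg _) h1 2
        nlinarith [sq_nonneg (‖a S t • (U S j t - U S' j t)‖ - ‖(a S t - a S' t) • U S' j t‖)]
  have hαt : ∀ t ∈ Icc 0 T, Tendsto (fun S => a S t) atTop (𝓝 (α t)) := fun t ht =>
    hα.tendsto_at ht
  have hut : ∀ t ∈ Icc 0 T, ∀ j, Tendsto (fun S => U S j t) atTop (𝓝 (u j t)) := fun t ht j =>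
    (hu j).tendsto_at ht
  have hvt : ∀ t ∈ Icc 0 T, ∀ j, Tendsto (fun S => V S j t) atTop (𝓝 (v j t)) := fun t ht j =>
    (hv j).tendsto_at ht
  have hαc : ContinuousOn α (Icc 0 T) :=
    hα.continuousOn (Frequently.of_forall fun S => (h S).system.cont)
  have huc : ∀ j, ContinuousOn (u j) (Icc 0 T) := fun j =>
    (hu j).continuousOn (Frequently.of_forall fun S t ht =>
      ((h S).system.mode j t ht).1.continuousWithinAt)
  have hvc : ∀ j, ContinuousOn (v j) (Icc 0 T) := fun j =>
    (hv j).continuousOn (Frequently.of_forall fun S t ht =>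
      ((h S).system.mode j t ht).2.continuousWithinAt)
  have henergy : ∀ t ∈ Icc 0 T, ∀ j, Tendsto (fun S => modeEnergy (lam j) (U S j t) (V S j t))
      atTop (𝓝 (modeEnergy (lam j) (u j t) (v j t))) := fun t ht j =>
    (((hut t ht j).norm.pow 2).const_mul _).add (((hvt t ht j).norm.pow 2).div_const _)
  have hmode : ∀ t ∈ Icc 0 T, ∀ j, modeEnergy (lam j) (u j t) (v j t) ≤
      2 * Real.exp T * e₀ j := fun t ht j =>
    le_of_tendsto' (henergy t ht j) fun S => (h S).mode_le t ht j
  have h0 : (0 : ℝ) ∈ Icc 0 T := ⟨le_rfl, hT0.le⟩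
  refine ⟨α, u, v, ⟨fun j t ht => ?_, hαc, fun t ht => ?_, fun t ht J => ?_⟩, fun j => ?_,
    fun w hw W hW t ht J => ?_, hmode, fun R a' U' V' h' hi' t ht j => ?_⟩
  · refine ⟨hasDerivWithinAt_of_tendstoUniformlyOn_Icc
      (fun S t ht => ((h S).system.mode j t ht).1) (fun t ht => hut t ht j) (hv j) (hvc j) ht, ?_⟩
    obtain ⟨G, hG⟩ := hGex j
    have hGeq : EqOn G (fun t => -(α t * lam j ^ 2) • u j t) (Icc 0 T) := fun t ht =>
      tendsto_nhds_unique (hG.tendsto_at ht)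
        ((((hαt t ht).mul_const _).neg).smul (hut t ht j))
    exact hasDerivWithinAt_of_tendstoUniformlyOn_Icc
      (fun S t ht => ((h S).system.mode j t ht).2) (fun t ht => hvt t ht j)
      (hG.congr_right hGeq)
      (((hαc.mul continuousOn_const).neg).smul (huc j)) ht
  · have hb : ∀ S j, ‖lam j ^ 2 * ‖U S j t‖ ^ 2‖ ≤ 2 * Real.exp T * (lam j * e₀ j) := by
      intro S j
      have hl : 0 < lam j := zero_lt_one.trans_le (hlam j)
      rw [Real.norm_of_nonneg (by positivity)]
      have h1 := (h S).mode_le t ht j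
      have h2 : lam j * ‖U S j t‖ ^ 2 ≤ modeEnergy (lam j) (U S j t) (V S j t) := by
        have : 0 ≤ ‖V S j t‖ ^ 2 / lam j := by positivity
        unfold modeEnergy; linarith
      have := mul_le_mul_of_nonneg_left (h2.trans h1) hl.le
      linarith
    have hsumb : Summable fun j => 2 * Real.exp T * (lam j * e₀ j) := hsum1.mul_left _
    have hlim := tendsto_tsum_of_dominated_convergence (𝓕 := (atTop : Filter (Finset ι))) hsumb
      (fun j => ((hut t ht j).norm.pow 2).const_mul (lam j ^ 2))
      (Eventually.of_forall fun S j => hb S j)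
    have heq : ∀ S, ∑' j, lam j ^ 2 * ‖U S j t‖ ^ 2 = a S t - 1 := fun S =>
      ((h S).system.hasSum t ht).tsum_eq
    simp only [heq] at hlim
    rw [tendsto_nhds_unique ((hαt t ht).sub_const 1) hlim]
    refine Summable.hasSum (hsumb.of_norm_bounded fun j => ?_)
    exact le_of_tendsto' (((hut t ht j).norm.pow 2).const_mul (lam j ^ 2)).norm fun S => hb S j
  · exact le_of_tendsto' (tendsto_finsetSum J fun j _ =>
      ((hut t ht j).norm.pow 2).const_mul (lam j ^ 3)) fun S => (h S).system.bound t ht J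
  · have hev : ∀ᶠ S : Finset ι in atTop, j ∈ S :=
      (eventually_ge_atTop {j}).mono fun S hS => Finset.singleton_subset_iff.1 hS
    exact ⟨tendsto_nhds_unique_of_eventuallyEq (hut 0 h0 j) tendsto_const_nhds
        (hev.mono fun S hS => ((h S).init j hS).1),
      tendsto_nhds_unique_of_eventuallyEq (hvt 0 h0 j) tendsto_const_nhds
        (hev.mono fun S hS => ((h S).init j hS).2)⟩
  · exact le_of_tendsto' (tendsto_finsetSum J fun j _ => (henergy t ht j).const_mul (w (lam j)))
      fun S => (h S).weighted w hw W hW t ht J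
  -- Uniqueness: any other system with the same data is the limit of the same approximations,
  -- because its distance to each of them is bounded by the tail `θ S`.
  · have hle : ∀ S, ‖U S j t - U' j t‖ ^ 2 ≤ stabilityConst T (max 1 R) * θ S := fun S => by
      obtain ⟨da, hda, hda1⟩ := (h S).exists_deriv
      have := ((h S).system.mono (le_max_left 1 R)).stability hlam (h'.mono (le_max_right 1 R))
        (h S).le_two hda hda1 (θ := θ S)
        (sum_modeEnergy_sub_le hlam hsum0 (fun j hj => by
          simp [(h S).init j hj, hi' j]) (fun j => by
          by_cases hj : j ∈ S
          · rw [((h S).init j hj).1, ((h S).init j hj).2, (hi' j).1, (hi' j).2]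
            simpa [modeEnergy, he₀] using he0 j
          · rw [((h S).zero j hj 0).1, ((h S).zero j hj 0).2, (hi' j).1, (hi' j).2]
            simp [modeEnergy])) ht
      exact (norm_sq_le_of_modeEnergy_le (hlam j) (by simpa using this.1 {j})).1
    have h1 : Tendsto (fun S => ‖U S j t - U' j t‖ ^ 2) atTop (𝓝 0) := by
      refine squeeze_zero (fun S => sq_nonneg _) hle ?_
      simpa using hθ0.const_mul (stabilityConst T (max 1 R))
    have h2 := tendsto_nhds_unique h1 (((hut t ht j).sub_const (U' j t)).norm.pow 2)
    have h3 : u j t - U' j t = 0 := by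
      rw [← norm_eq_zero]; exact pow_eq_zero_iff two_ne_zero |>.1 h2.symm
    exact (sub_eq_zero.1 h3).symm

end Limit

/-! ## Fourier coefficients -/

/-- The Hilbert basis of characters of the torus. -/
noncomputable def fourierBasis (d : ℕ) : HilbertBasis (Fin d → ℤ) ℂ (L2Torus d) :=
  UnitAddTorus.mFourierBasis

section Fourier

variable {d : ℕ}

theorem coeff_eq_repr (u : L2Torus d) (j : Fin d → ℤ) : coeff u j = (fourierBasis d).repr u j :=
  (UnitAddTorus.mFourierBasis_repr u j).symm

theorem coeff_sub (u u' : L2Torus d) (j : Fin d → ℤ) :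
    coeff (u - u') j = coeff u j - coeff u' j := by
  simp [coeff_eq_repr]

theorem coeff_real_smul (c : ℝ) (u : L2Torus d) (j : Fin d → ℤ) :
    coeff (c • u) j = c • coeff u j := by
  rw [RCLike.real_smul_eq_coe_smul (K := ℂ) c u, coeff_eq_repr, map_smul, coeff_eq_repr]
  exact (RCLike.real_smul_eq_coe_smul (K := ℂ) c _).symm

theorem coeff_ext {u u' : L2Torus d} (h : ∀ j, coeff u j = coeff u' j) : u = u' := by
  apply (fourierBasis d).repr.injective
  ext j
  rw [← coeff_eq_repr, ← coeff_eq_repr, h]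

theorem hasSum_norm_sq_coeff (u : L2Torus d) :
    HasSum (fun j => ‖coeff u j‖ ^ 2) (∫ x, ‖u x‖ ^ 2 ∂(torusMeasure d)) :=
  UnitAddTorus.hasSum_sq_mFourierCoeff u

theorem exists_coeff_eq {c : (Fin d → ℤ) → ℂ} (hc : Summable fun j => ‖c j‖ ^ 2) :
    ∃ u : L2Torus d, ∀ j, coeff u j = c j := by
  have hmem : Memℓp c 2 := memℓp_gen (by simpa using hc)
  refine ⟨(fourierBasis d).repr.symm ⟨c, hmem⟩, fun j => ?_⟩
  rw [coeff_eq_repr, LinearIsometryEquiv.apply_symm_apply]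

theorem coeff_star (u : L2Torus d) (j : Fin d → ℤ) :
    coeff (star u) j = starRingEnd ℂ (coeff u (-j)) := by
  unfold coeff
  rw [← integral_conj]
  refine integral_congr_ae ?_
  filter_upwards [Lp.coeFn_star u] with x hx
  rw [hx, map_mul, UnitAddTorus.mFourier_neg, neg_neg]
  rfl

/-- Being real-valued means `star u = u`, which can be read on Fourier coefficients. -/
theorem real_valued_iff (u : L2Torus d) :
    (∀ᵐ x ∂(torusMeasure d), (u x).im = 0) ↔
      ∀ j, coeff u (-j) = starRingEnd ℂ (coeff u j) := by
  have h1 : (∀ᵐ x ∂(torusMeasure d), (u x).im = 0) ↔ star u = u := by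
    constructor
    · intro h
      refine Lp.ext ?_
      filter_upwards [Lp.coeFn_star u, h] with x hx him
      rw [hx]
      exact Complex.conj_eq_iff_im.2 him
    · intro h
      have h2 := Lp.coeFn_star u
      rw [h] at h2
      filter_upwards [h2] with x hx
      exact Complex.conj_eq_iff_im.1 hx.symm
  rw [h1]
  constructor
  · intro h j
    conv_lhs => rw [← h]
    rw [coeff_star, neg_neg]
  · intro h
    refine coeff_ext fun j => ?_
    rw [coeff_star, h, Complex.conj_conj]

/-! ## Frequencies -/

/-- The nonzero frequencies. -/
abbrev Freq (d : ℕ) : Type := {j : Fin d → ℤ // j ≠ 0}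

/-- The integer `|j|²`. -/
def freqSq (j : Fin d → ℤ) : ℤ := ∑ i, j i ^ 2

theorem freqNorm_sq (j : Fin d → ℤ) : freqNorm j ^ 2 = freqSq j := by
  rw [freqNorm, Real.sq_sqrt (by positivity), freqSq]
  push_cast
  rfl

theorem freqNorm_nonneg (j : Fin d → ℤ) : 0 ≤ freqNorm j := Real.sqrt_nonneg _

theorem freqNorm_neg (j : Fin d → ℤ) : freqNorm (-j) = freqNorm j := by
  simp [freqNorm]

theorem freqNorm_zero : freqNorm (0 : Fin d → ℤ) = 0 := by
  simp [freqNorm]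

theorem one_le_freqNorm (j : Freq d) : 1 ≤ freqNorm j.1 := by
  have h1 : (1 : ℤ) ≤ freqSq j.1 := by
    obtain ⟨i, hi⟩ := Function.ne_iff.1 j.2
    have h2 : j.1 i ^ 2 ≤ freqSq j.1 :=
      Finset.single_le_sum (f := fun i => j.1 i ^ 2) (fun i _ => sq_nonneg _) (Finset.mem_univ i)
    have h3 : 0 < j.1 i ^ 2 := lt_of_le_of_ne (sq_nonneg _) (pow_ne_zero 2 hi).symm
    omega
  have h2 : (1 : ℝ) ≤ freqNorm j.1 ^ 2 := by
    rw [freqNorm_sq]; exact_mod_cast h1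
  nlinarith [freqNorm_nonneg j.1]

/-- The weight `|j| ^ (2 m₀ - 2)`. -/
noncomputable def gapWeight (d : ℕ) (x : ℝ) : ℝ := if d = 1 then 1 else x

theorem one_le_gapWeight (j : Freq d) : 1 ≤ gapWeight d (freqNorm j.1) := by
  unfold gapWeight
  split_ifs
  · exact le_rfl
  · exact one_le_freqNorm j

/-- This identifies the weight needed by the small denominators with the `H^{m₀+1/2} × H^{m₀-1/2}`
energy. -/
theorem rpow_m₀_eq (x : ℝ) : x ^ (2 * m₀ d) = x ^ 2 * gapWeight d x := by
  unfold m₀ gapWeight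
  split_ifs
  · norm_num
  · rw [show (2 * (3 / 2) : ℝ) = (3 : ℕ) by norm_num, Real.rpow_natCast]
    ring

theorem one_le_m₀ : 1 ≤ m₀ d := by
  unfold m₀
  split_ifs <;> norm_num

/-- Small denominators. -/
theorem inv_abs_freqNorm_sub_le (j k : Freq d) :
    |freqNorm j.1 - freqNorm k.1|⁻¹ ≤ 3 * gapWeight d (freqNorm j.1) := by
  have hj := one_le_freqNorm j
  have hk := one_le_freqNorm k
  have hw := one_le_gapWeight j
  rcases eq_or_ne (freqNorm j.1) (freqNorm k.1) with h | h
  · rw [h, sub_self, abs_zero, inv_zero, ← h]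
    linarith
  have hpos : 0 < |freqNorm j.1 - freqNorm k.1| := abs_pos.2 (sub_ne_zero.2 h)
  by_cases hd : d = 1
  · subst hd
    have hint : ∀ j : Fin 1 → ℤ, freqNorm j = ((|j 0| : ℤ) : ℝ) := fun _ => by
      simp [freqNorm, Real.sqrt_sq_eq_abs]
    have h1 : (1 : ℝ) ≤ |freqNorm j.1 - freqNorm k.1| := by
      rw [hint, hint] at h ⊢
      have h2 : (|j.1 0| : ℤ) - |k.1 0| ≠ 0 := fun h3 => h (by exact_mod_cast sub_eq_zero.1 h3)
      exact_mod_cast Int.one_le_abs h2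
    exact (inv_le_one_of_one_le₀ h1).trans (by linarith)
  -- Distinct lengths have squares that are distinct integers, so `1/||j| - |k||` is at most `|j| +
  -- |k|`. This is enough unless `|k| ≥ 2|j|`, when the gap itself is at least `|j|`.
  · have hsq : 1 ≤ |freqNorm j.1 - freqNorm k.1| * (freqNorm j.1 + freqNorm k.1) := by
      have e : |freqNorm j.1 - freqNorm k.1| * (freqNorm j.1 + freqNorm k.1) =
          |freqNorm j.1 ^ 2 - freqNorm k.1 ^ 2| := by
        rw [sq_sub_sq, abs_mul, abs_of_pos (by linarith : 0 < freqNorm j.1 + freqNorm k.1), mul_comm]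
      have h2 : freqSq j.1 - freqSq k.1 ≠ 0 := fun h3 => h (by
        have h4 : freqNorm j.1 ^ 2 = freqNorm k.1 ^ 2 := by
          rw [freqNorm_sq, freqNorm_sq, sub_eq_zero.1 h3]
        exact (pow_left_inj₀ (freqNorm_nonneg _) (freqNorm_nonneg _) two_ne_zero).1 h4)
      rw [e, freqNorm_sq, freqNorm_sq]
      exact_mod_cast Int.one_le_abs h2
    simp only [gapWeight, hd, if_false]
    rw [inv_le_iff_one_le_mul₀ hpos]
    rcases le_or_gt (2 * freqNorm j.1) (freqNorm k.1) with h3 | h3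
    · have h4 : freqNorm j.1 ≤ |freqNorm j.1 - freqNorm k.1| := by
        rw [abs_sub_comm]
        exact (by linarith : freqNorm j.1 ≤ freqNorm k.1 - freqNorm j.1).trans (le_abs_self _)
      nlinarith
    · have h4 : freqNorm j.1 + freqNorm k.1 ≤ 3 * freqNorm j.1 := by linarith
      have := mul_le_mul_of_nonneg_left h4 hpos.le
      linarith

/-- Negation of frequencies. -/
def negFreq (d : ℕ) : Freq d ≃ Freq d where
  toFun j := ⟨-j.1, neg_ne_zero.2 j.2⟩
  invFun j := ⟨-j.1, neg_ne_zero.2 j.2⟩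
  left_inv j := by simp
  right_inv j := by simp

theorem freqNorm_negFreq (j : Freq d) : freqNorm (negFreq d j).1 = freqNorm j.1 := freqNorm_neg _

/-! ## Sobolev norms -/

theorem sobNorm_nonneg (s : ℝ) (u : L2Torus d) : 0 ≤ sobNorm s u := Real.sqrt_nonneg _

theorem sobTerm_nonneg (s : ℝ) (c : ℂ) (j : Fin d → ℤ) : 0 ≤ ‖c‖ ^ 2 * freqNorm j ^ (2 * s) :=
  mul_nonneg (sq_nonneg _) (Real.rpow_nonneg (freqNorm_nonneg _) _)

theorem sobNorm_sq (s : ℝ) (u : L2Torus d) :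
    sobNorm s u ^ 2 = ∑' j : Freq d, ‖coeff u j.1‖ ^ 2 * freqNorm j.1 ^ (2 * s) :=
  Real.sq_sqrt (tsum_nonneg fun _ => sobTerm_nonneg s _ _)

theorem MemHs.sum_le {s : ℝ} {u : L2Torus d} (h : MemHs s u) (J : Finset (Freq d)) :
    ∑ j ∈ J, ‖coeff u j.1‖ ^ 2 * freqNorm j.1 ^ (2 * s) ≤ sobNorm s u ^ 2 := by
  rw [sobNorm_sq]
  exact h.finite_norm.sum_le_tsum J fun j _ => sobTerm_nonneg s _ _

theorem summable_sobTerm_sub {s : ℝ} {c c' : Freq d → ℂ}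
    (hc : Summable fun j : Freq d => ‖c j‖ ^ 2 * freqNorm j.1 ^ (2 * s))
    (hc' : Summable fun j : Freq d => ‖c' j‖ ^ 2 * freqNorm j.1 ^ (2 * s)) :
    Summable fun j : Freq d => ‖c j - c' j‖ ^ 2 * freqNorm j.1 ^ (2 * s) := by
  refine ((hc.mul_left 2).add (hc'.mul_left 2)).of_nonneg_of_le
    (fun j => sobTerm_nonneg s _ _) fun j => ?_
  rw [← mul_assoc, ← mul_assoc, ← add_mul]
  refine mul_le_mul_of_nonneg_right ?_ (Real.rpow_nonneg (freqNorm_nonneg _) _)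
  have h1 := pow_le_pow_left₀ (norm_nonneg _) (norm_sub_le (c j) (c' j)) 2
  nlinarith [sq_nonneg (‖c j‖ - ‖c' j‖)]

theorem summable_sobTerm_smul {s : ℝ} (x : ℝ) {c : Freq d → ℂ}
    (hc : Summable fun j : Freq d => ‖c j‖ ^ 2 * freqNorm j.1 ^ (2 * s)) :
    Summable fun j : Freq d => ‖x • c j‖ ^ 2 * freqNorm j.1 ^ (2 * s) := by
  refine (hc.mul_left (x ^ 2)).congr fun j => ?_
  rw [norm_smul, mul_pow, Real.norm_eq_abs, sq_abs, mul_assoc]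

theorem norm_coeff_le_sobNorm {s : ℝ} (hs : 0 ≤ s) {u : L2Torus d}
    (hu : Summable fun j : Freq d => ‖coeff u j.1‖ ^ 2 * freqNorm j.1 ^ (2 * s)) (j : Freq d) :
    ‖coeff u j.1‖ ≤ sobNorm s u := by
  apply Real.le_sqrt_of_sq_le
  refine le_trans ?_ (hu.le_tsum j fun k _ => sobTerm_nonneg s _ _)
  exact le_mul_of_one_le_right (sq_nonneg _)
    (Real.one_le_rpow (one_le_freqNorm j) (by linarith))

/-- A criterion of convergence to zero in `H^s`, by dominated convergence. -/
theorem tendsto_sobNorm_zero {s : ℝ} {l : Filter ℝ} {w : ℝ → L2Torus d} {g : Freq d → ℝ}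
    (hg : Summable fun j : Freq d => g j * freqNorm j.1 ^ (2 * s))
    (hlim : ∀ j : Freq d, Tendsto (fun τ => coeff (w τ) j.1) l (𝓝 0))
    (hle : ∀ᶠ τ in l, ∀ j : Freq d, ‖coeff (w τ) j.1‖ ^ 2 ≤ g j) :
    Tendsto (fun τ => sobNorm s (w τ)) l (𝓝 0) := by
  have h1 : Tendsto (fun τ => ∑' j : Freq d, ‖coeff (w τ) j.1‖ ^ 2 * freqNorm j.1 ^ (2 * s)) l
      (𝓝 (∑' _ : Freq d, 0)) := by
    refine tendsto_tsum_of_dominated_convergence hg (fun j => ?_) (hle.mono fun τ h j => ?_)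
    · simpa using ((hlim j).norm.pow 2).mul_const (freqNorm j.1 ^ (2 * s))
    · rw [Real.norm_of_nonneg (sobTerm_nonneg s _ _)]
      exact mul_le_mul_of_nonneg_right (h j) (Real.rpow_nonneg (freqNorm_nonneg _) _)
  rw [tsum_zero] at h1
  simpa [sobNorm] using h1.sqrt

theorem hasSum_freq_iff (u : L2Torus d) {A : ℝ} :
    HasSum (fun j : Freq d => freqNorm j.1 ^ 2 * ‖coeff u j.1‖ ^ 2) A ↔
      HasSum (fun j : Fin d → ℤ => freqNorm j ^ 2 * ‖coeff u j‖ ^ 2) A := by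
  refine hasSum_subtype_iff_of_support_subset (s := {j : Fin d → ℤ | j ≠ 0})
    (f := fun j : Fin d → ℤ => freqNorm j ^ 2 * ‖coeff u j‖ ^ 2) ?_
  intro j hj
  by_contra hj0
  rw [mem_ofPred_eq, not_not] at hj0
  subst hj0
  exact hj (by simp [freqNorm_zero])

/-- Parseval for each component of the gradient, using `|j|² = ∑ j_i²`. -/
theorem hasSum_integralSq {u : L2Torus d} {g : Fin d → L2Torus d} (h : IsGradient u g) :
    HasSum (fun j : Freq d => freqNorm j.1 ^ 2 * ‖coeff u j.1‖ ^ 2) (integralSq g) := by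
  have h1 : integralSq g = ∑ i, ∫ x, ‖g i x‖ ^ 2 ∂(torusMeasure d) := by
    refine integral_finsetSum _ fun i _ => ?_
    exact (Lp.memLp (g i)).integrable_norm_pow two_ne_zero
  have h2 : HasSum (fun j : Fin d → ℤ => freqNorm j ^ 2 * ‖coeff u j‖ ^ 2) (integralSq g) := by
    rw [h1]
    refine (hasSum_sum fun i _ => hasSum_norm_sq_coeff (g i)).congr_fun fun j => ?_
    rw [freqNorm_sq, freqSq, Int.cast_sum, Finset.sum_mul]
    refine Finset.sum_congr rfl fun i _ => ?_
    rw [h i j, norm_mul, norm_mul, Complex.norm_I, one_mul, mul_pow, Complex.norm_intCast, sq_abs]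
    push_cast
    ring
  exact (hasSum_freq_iff u).2 h2

theorem exists_isGradient {u : L2Torus d}
    (hu : Summable fun j : Freq d => freqNorm j.1 ^ 2 * ‖coeff u j.1‖ ^ 2) :
    ∃ g : Fin d → L2Torus d, IsGradient u g := by
  have h2 : Summable fun j : Fin d → ℤ => freqNorm j ^ 2 * ‖coeff u j‖ ^ 2 :=
    ((hasSum_freq_iff u).1 hu.hasSum).summable
  have h3 : ∀ i, ∃ v : L2Torus d, ∀ j, coeff v j = Complex.I * (j i : ℂ) * coeff u j := fun i =>
    exists_coeff_eq (h2.of_nonneg_of_le (fun j => sq_nonneg _) fun j => by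
      rw [norm_mul, norm_mul, Complex.norm_I, one_mul, mul_pow, Complex.norm_intCast, sq_abs]
      refine mul_le_mul_of_nonneg_right ?_ (sq_nonneg _)
      rw [freqNorm_sq, freqSq]
      push_cast
      exact Finset.single_le_sum (f := fun i => (j i : ℝ) ^ 2) (fun i _ => sq_nonneg _)
        (Finset.mem_univ i))
  choose g hg using h3
  exact ⟨g, hg⟩

end Fourier

/-! ## From modes to functions on the torus -/

section Torus

variable {d : ℕ} {T : ℝ}

/-- The summability condition sits inside the existential so that a function can be chosen for every
real time, although summability is known only on `[0,T]`. -/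
theorem exists_coeff_freq_eq (c : Freq d → ℂ) : ∃ u : L2Torus d,
    (Summable fun j => ‖c j‖ ^ 2) → coeff u 0 = 0 ∧ ∀ j : Freq d, coeff u j.1 = c j := by
  classical
  by_cases hc : Summable fun j => ‖c j‖ ^ 2
  · set c' : (Fin d → ℤ) → ℂ := fun j => if h : j ≠ 0 then c ⟨j, h⟩ else 0 with hc'
    have h1 : Summable fun j => ‖c' j‖ ^ 2 := by
      refine (Function.Injective.summable_iff (Subtype.val_injective (p := fun j : Fin d → ℤ =>
        j ≠ 0)) fun j hj => ?_).1 (hc.congr fun j => ?_)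
      · have : j = 0 := by
          by_contra h
          exact hj ⟨⟨j, h⟩, rfl⟩
        simp [hc', this]
      · simp [hc', j.2]
    obtain ⟨u, hu⟩ := exists_coeff_eq h1
    exact ⟨u, fun _ => ⟨by simp [hu, hc'], fun j => by simp [hu, hc', j.2]⟩⟩
  · exact ⟨0, fun h => absurd h hc⟩

/-- The absolute value makes `|x| ^ (2 * s)` a weight that is nonnegative on all reals, as the
weighted estimates require. -/
theorem rpow_mul_modeEnergy (s : ℝ) (j : Freq d) (u v : ℂ) :
    |freqNorm j.1| ^ (2 * s) * modeEnergy (freqNorm j.1) u v =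
      ‖u‖ ^ 2 * freqNorm j.1 ^ (2 * (s + 1 / 2)) + ‖v‖ ^ 2 * freqNorm j.1 ^ (2 * (s - 1 / 2)) := by
  have hl : 0 < freqNorm j.1 := zero_lt_one.trans_le (one_le_freqNorm j)
  rw [abs_of_pos hl, show 2 * (s + 1 / 2) = 2 * s + 1 by ring,
    show 2 * (s - 1 / 2) = 2 * s - 1 by ring, Real.rpow_add hl, Real.rpow_sub hl, Real.rpow_one]
  unfold modeEnergy
  field_simp

theorem sum_rpow_mul_modeEnergy_le {s : ℝ} {u v : L2Torus d} (hu : MemHs (s + 1 / 2) u)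
    (hv : MemHs (s - 1 / 2) v) (J : Finset (Freq d)) :
    ∑ j ∈ J, |freqNorm j.1| ^ (2 * s) * modeEnergy (freqNorm j.1) (coeff u j.1) (coeff v j.1) ≤
      sobNorm (s + 1 / 2) u ^ 2 + sobNorm (s - 1 / 2) v ^ 2 := by
  simp only [rpow_mul_modeEnergy, Finset.sum_add_distrib]
  exact add_le_add (hu.sum_le J) (hv.sum_le J)

theorem sobNorm_sq_add_le {s W : ℝ} {u v : L2Torus d} (hW : ∀ J : Finset (Freq d),
    ∑ j ∈ J, |freqNorm j.1| ^ (2 * s) * modeEnergy (freqNorm j.1) (coeff u j.1) (coeff v j.1) ≤ W) :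
    sobNorm (s + 1 / 2) u ^ 2 + sobNorm (s - 1 / 2) v ^ 2 ≤ W := by
  simp only [rpow_mul_modeEnergy, Finset.sum_add_distrib] at hW
  have h1 : Summable fun j : Freq d => ‖coeff u j.1‖ ^ 2 * freqNorm j.1 ^ (2 * (s + 1 / 2)) :=
    summable_of_sum_le (fun j => sobTerm_nonneg _ _ _) fun J =>
      (le_add_of_nonneg_right (Finset.sum_nonneg fun j _ => sobTerm_nonneg _ _ _)).trans (hW J)
  have h2 : Summable fun j : Freq d => ‖coeff v j.1‖ ^ 2 * freqNorm j.1 ^ (2 * (s - 1 / 2)) :=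
    summable_of_sum_le (fun j => sobTerm_nonneg _ _ _) fun J =>
      (le_add_of_nonneg_left (Finset.sum_nonneg fun j _ => sobTerm_nonneg _ _ _)).trans (hW J)
  rw [sobNorm_sq, sobNorm_sq]
  exact le_of_tendsto' (h1.hasSum.add h2.hasSum) fun J => by
    rw [Finset.sum_add_distrib]; exact hW J

theorem norm_sub_sq_le {x y : ℂ} {g : ℝ} (hx : ‖x‖ ^ 2 ≤ g) (hy : ‖y‖ ^ 2 ≤ g) :
    ‖x - y‖ ^ 2 ≤ 4 * g := by
  have h1 := pow_le_pow_left₀ (norm_nonneg _) (norm_sub_le x y) 2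
  nlinarith [sq_nonneg (‖x‖ - ‖y‖)]

theorem isC0_of_dominated {s : ℝ} {u : ℝ → L2Torus d} {g : Freq d → ℝ}
    (hg : Summable fun j : Freq d => g j * freqNorm j.1 ^ (2 * s))
    (hreal : ∀ t ∈ Icc 0 T, ∀ j, coeff (u t) (-j) = starRingEnd ℂ (coeff (u t) j))
    (hzero : ∀ t ∈ Icc 0 T, coeff (u t) 0 = 0)
    (hcont : ∀ j : Freq d, ContinuousOn (fun t => coeff (u t) j.1) (Icc 0 T))
    (hle : ∀ t ∈ Icc 0 T, ∀ j : Freq d, ‖coeff (u t) j.1‖ ^ 2 ≤ g j) : IsC0 T s u := by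
  refine ⟨fun t ht => ⟨(real_valued_iff _).2 (hreal t ht), hzero t ht, ?_⟩, fun t ht => ?_⟩
  · exact hg.of_nonneg_of_le (fun j => sobTerm_nonneg s _ _) fun j =>
      mul_le_mul_of_nonneg_right (hle t ht j) (Real.rpow_nonneg (freqNorm_nonneg _) _)
  · refine tendsto_sobNorm_zero (g := fun j => 4 * g j)
      ((hg.mul_left 4).congr fun j => by ring) (fun j => ?_) ?_
    · simp only [coeff_sub]
      simpa using (hcont j t ht).tendsto.sub_const (coeff (u t) j.1)
    · filter_upwards [self_mem_nhdsWithin] with τ hτ j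
      rw [coeff_sub]
      exact norm_sub_sq_le (hle τ hτ j) (hle t ht j)

theorem isC1_of_dominated {s : ℝ} {u v : ℝ → L2Torus d} {g : Freq d → ℝ}
    (hg : Summable fun j : Freq d => g j * freqNorm j.1 ^ (2 * s))
    (hu : IsC0 T s u) (hv : IsC0 T s v)
    (hder : ∀ j : Freq d, ∀ t ∈ Icc 0 T,
      HasDerivWithinAt (fun t => coeff (u t) j.1) (coeff (v t) j.1) (Icc 0 T) t)
    (hle : ∀ t ∈ Icc 0 T, ∀ j : Freq d, ‖coeff (v t) j.1‖ ^ 2 ≤ g j) : IsC1 T s u v := by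
  refine ⟨hu, hv, fun t ht => ?_⟩
  refine tendsto_sobNorm_zero (g := fun j => 4 * g j)
    ((hg.mul_left 4).congr fun j => by ring) (fun j => ?_) ?_
  · simp only [coeff_sub, coeff_real_smul]
    have := (hasDerivWithinAt_iff_tendsto_slope.1 (hder j t ht)).sub_const (coeff (v t) j.1)
    simpa [slope_def_module] using this
  · filter_upwards [self_mem_nhdsWithin] with τ hτ j
    rw [coeff_sub, coeff_real_smul, coeff_sub]
    refine norm_sub_sq_le ?_ (hle t ht j)
    have hb : ∀ x ∈ Icc 0 T, ‖coeff (v x) j.1‖ ≤ √(g j) := fun x hx =>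
      Real.le_sqrt_of_sq_le (hle x hx j)
    -- By the mean value inequality the difference quotients have the same majorant as `v`.
    have h1 := (convex_Icc 0 T).norm_image_sub_le_of_norm_hasDerivWithin_le (hder j) hb ht hτ.1
    have hne : 0 < ‖τ - t‖ := norm_pos_iff.2 (sub_ne_zero.2 hτ.2)
    have h2 : ‖(τ - t)⁻¹ • (coeff (u τ) j.1 - coeff (u t) j.1)‖ ≤ √(g j) := by
      rw [norm_smul, norm_inv, inv_mul_le_iff₀ hne, mul_comm]
      exact h1
    calc _ ≤ √(g j) ^ 2 := pow_le_pow_left₀ (norm_nonneg _) h2 2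
      _ = g j := Real.sq_sqrt ((sq_nonneg _).trans (hle t ht j))

/-- Bounds mode by mode give regularity and bounds in Sobolev spaces. -/
theorem regularity_of_modes {K : ℝ} {α β : L2Torus d} {u v : ℝ → L2Torus d}
    (hrealu : ∀ t ∈ Icc 0 T, ∀ j, coeff (u t) (-j) = starRingEnd ℂ (coeff (u t) j))
    (hrealv : ∀ t ∈ Icc 0 T, ∀ j, coeff (v t) (-j) = starRingEnd ℂ (coeff (v t) j))
    (hzerou : ∀ t ∈ Icc 0 T, coeff (u t) 0 = 0) (hzerov : ∀ t ∈ Icc 0 T, coeff (v t) 0 = 0)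
    (hder : ∀ j : Freq d, ∀ t ∈ Icc 0 T,
      HasDerivWithinAt (fun t => coeff (u t) j.1) (coeff (v t) j.1) (Icc 0 T) t)
    (hcontv : ∀ j : Freq d, ContinuousOn (fun t => coeff (v t) j.1) (Icc 0 T))
    (hmode : ∀ t ∈ Icc 0 T, ∀ j : Freq d,
      modeEnergy (freqNorm j.1) (coeff (u t) j.1) (coeff (v t) j.1) ≤
        K * modeEnergy (freqNorm j.1) (coeff α j.1) (coeff β j.1))
    (hw : ∀ w : ℝ → ℝ, (∀ x, 0 ≤ w x) → ∀ W, (∀ J : Finset (Freq d),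
      ∑ j ∈ J, w (freqNorm j.1) *
        modeEnergy (freqNorm j.1) (coeff α j.1) (coeff β j.1) ≤ W) → ∀ t ∈ Icc 0 T,
      ∀ J : Finset (Freq d), ∑ j ∈ J, w (freqNorm j.1) *
        modeEnergy (freqNorm j.1) (coeff (u t) j.1) (coeff (v t) j.1) ≤ 36 * W)
    {s : ℝ} (hα : MemHs (s + 1 / 2) α) (hβ : MemHs (s - 1 / 2) β) :
    IsC0 T (s + 1 / 2) u ∧ IsC1 T (s - 1 / 2) u v ∧
      ∀ t ∈ Icc 0 T, sobNorm (s + 1 / 2) (u t) + sobNorm (s - 1 / 2) (v t) ≤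
        12 * (sobNorm (s + 1 / 2) α + sobNorm (s - 1 / 2) β) := by
  set e₀ : Freq d → ℝ := fun j => modeEnergy (freqNorm j.1) (coeff α j.1) (coeff β j.1) with he₀
  have hpos : ∀ j : Freq d, 0 < freqNorm j.1 := fun j => zero_lt_one.trans_le (one_le_freqNorm j)
  have hsum : Summable fun j : Freq d => K * (|freqNorm j.1| ^ (2 * s) * e₀ j) :=
    (summable_of_sum_le (fun j => mul_nonneg (Real.rpow_nonneg (abs_nonneg _) _)
      (modeEnergy_nonneg (one_le_freqNorm j) _ _)) (sum_rpow_mul_modeEnergy_le hα hβ)).mul_left K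
  have hgu : Summable fun j : Freq d =>
      K * e₀ j / freqNorm j.1 * freqNorm j.1 ^ (2 * (s + 1 / 2)) := hsum.congr fun j => by
    have := hpos j
    rw [abs_of_pos (hpos j), show 2 * (s + 1 / 2) = 2 * s + 1 by ring, Real.rpow_add (hpos j),
      Real.rpow_one]
    field_simp
  have hgv : Summable fun j : Freq d =>
      freqNorm j.1 * (K * e₀ j) * freqNorm j.1 ^ (2 * (s - 1 / 2)) := hsum.congr fun j => by
    have := hpos j
    rw [abs_of_pos (hpos j), show 2 * (s - 1 / 2) = 2 * s - 1 by ring, Real.rpow_sub (hpos j),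
      Real.rpow_one]
    field_simp
  have hleu : ∀ t ∈ Icc 0 T, ∀ j : Freq d, ‖coeff (u t) j.1‖ ^ 2 ≤ K * e₀ j / freqNorm j.1 := by
    intro t ht j
    rw [le_div_iff₀' (hpos j)]
    refine le_trans ?_ (hmode t ht j)
    unfold modeEnergy
    have := hpos j
    exact le_add_of_nonneg_right (by positivity)
  have hlev : ∀ t ∈ Icc 0 T, ∀ j : Freq d, ‖coeff (v t) j.1‖ ^ 2 ≤ freqNorm j.1 * (K * e₀ j) :=
    fun t ht j => (norm_sq_le_of_modeEnergy_le (one_le_freqNorm j) (hmode t ht j)).2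
  have hgu' : Summable fun j : Freq d =>
      K * e₀ j / freqNorm j.1 * freqNorm j.1 ^ (2 * (s - 1 / 2)) := by
    -- `K` has no assumed sign, hence the absolute values.
    refine hgu.abs.of_norm_bounded fun j => ?_
    rw [Real.norm_eq_abs, abs_mul, abs_mul]
    refine mul_le_mul_of_nonneg_left ?_ (abs_nonneg _)
    rw [abs_of_nonneg (Real.rpow_nonneg (hpos j).le _),
      abs_of_nonneg (Real.rpow_nonneg (hpos j).le _)]
    exact Real.rpow_le_rpow_of_exponent_le (one_le_freqNorm j) (by linarith)
  have hcontu : ∀ j : Freq d, ContinuousOn (fun t => coeff (u t) j.1) (Icc 0 T) :=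
    fun j t ht => (hder j t ht).continuousWithinAt
  refine ⟨isC0_of_dominated hgu hrealu hzerou hcontu hleu,
    isC1_of_dominated hgv (isC0_of_dominated hgu' hrealu hzerou hcontu hleu)
      (isC0_of_dominated hgv hrealv hzerov hcontv hlev) hder hlev, fun t ht => ?_⟩
  have hbound := sobNorm_sq_add_le (hw (fun x => |x| ^ (2 * s))
    (fun x => Real.rpow_nonneg (abs_nonneg x) _) _ (sum_rpow_mul_modeEnergy_le hα hβ) t ht)
  have h1 := sobNorm_nonneg (s + 1 / 2) α
  have h2 := sobNorm_nonneg (s - 1 / 2) β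
  have h3 := sobNorm_nonneg (s + 1 / 2) (u t)
  have h4 := sobNorm_nonneg (s - 1 / 2) (v t)
  -- The square of the left side is at most `2 · 36` times the initial sum of squares, and `72 ≤
  -- 12²`.
  refine (pow_le_pow_iff_left₀ (by positivity) (by positivity) two_ne_zero).1 ?_
  nlinarith [sq_nonneg (sobNorm (s + 1 / 2) (u t) - sobNorm (s - 1 / 2) (v t)),
    mul_nonneg h1 h2]

/-- The modes of a solution on the torus. -/
theorem IsSolution.exists_modeSystem {α β : L2Torus d} {u v : ℝ → L2Torus d}
    (h : IsSolution T (m₀ d) α β u v) : ∃ R a, ModeSystem (fun j : Freq d => freqNorm j.1) T R a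
      (fun j t => coeff (u t) j.1) (fun j t => coeff (v t) j.1) := by
  have hm := one_le_m₀ (d := d)
  have hcube : ∀ j : Freq d, freqNorm j.1 ^ 3 ≤ freqNorm j.1 ^ (2 * (m₀ d + 1 / 2)) := fun j => by
    rw [← Real.rpow_natCast]
    exact Real.rpow_le_rpow_of_exponent_le (one_le_freqNorm j) (by push_cast; linarith)
  have hone : ∀ j : Freq d, freqNorm j.1 ≤ freqNorm j.1 ^ (2 * (m₀ d - 1 / 2)) := fun j => by
    conv_lhs => rw [← Real.rpow_one (freqNorm j.1)]
    exact Real.rpow_le_rpow_of_exponent_le (one_le_freqNorm j) (by linarith)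
  obtain ⟨R, hR⟩ : ∃ R, ∀ t ∈ Icc 0 T, ∀ J : Finset (Freq d),
      ∑ j ∈ J, freqNorm j.1 ^ 3 * ‖coeff (u t) j.1‖ ^ 2 ≤ R := by
    -- Continuity in `H^{m₀+1/2}` gives bounds near each time, and compactness makes them uniform.
    refine isCompact_Icc.induction_on (p := fun s => ∃ R, ∀ t ∈ s, ∀ J : Finset (Freq d),
      ∑ j ∈ J, freqNorm j.1 ^ 3 * ‖coeff (u t) j.1‖ ^ 2 ≤ R) ⟨0, by simp⟩
      (fun s s' hs ⟨R, hR⟩ => ⟨R, fun t ht => hR t (hs ht)⟩)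
      (fun s s' ⟨R, hR⟩ ⟨R', hR'⟩ => ⟨max R R', fun t ht J => ?_⟩) fun t ht => ?_
    · rcases ht with ht | ht
      · exact (hR t ht J).trans (le_max_left _ _)
      · exact (hR' t ht J).trans (le_max_right _ _)
    · have hev := (h.regular.continuous t ht).eventually_lt_const zero_lt_one
      refine ⟨_, inter_mem hev self_mem_nhdsWithin,
        2 + 2 * sobNorm (m₀ d + 1 / 2) (u t) ^ 2, fun τ hτ J => ?_⟩
      have hsub := summable_sobTerm_sub (h.regular.mem τ hτ.2).finite_norm
        (h.regular.mem t ht).finite_norm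
      simp only [← coeff_sub] at hsub
      have h1 : ∑ j ∈ J, ‖coeff (u τ - u t) j.1‖ ^ 2 * freqNorm j.1 ^ (2 * (m₀ d + 1 / 2)) ≤ 1 := by
        refine (hsub.sum_le_tsum J fun j _ => sobTerm_nonneg _ _ _).trans ?_
        rw [← sobNorm_sq]
        exact pow_le_one₀ (sobNorm_nonneg _ _) (le_of_lt hτ.1)
      have h2 := (h.regular.mem t ht).sum_le J
      have h3 : ∑ j ∈ J, freqNorm j.1 ^ 3 * ‖coeff (u τ) j.1‖ ^ 2 ≤ ∑ j ∈ J,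
          (2 * (‖coeff (u τ - u t) j.1‖ ^ 2 * freqNorm j.1 ^ (2 * (m₀ d + 1 / 2))) +
            2 * (‖coeff (u t) j.1‖ ^ 2 * freqNorm j.1 ^ (2 * (m₀ d + 1 / 2)))) := by
        refine Finset.sum_le_sum fun j _ => ?_
        rw [coeff_sub]
        have h4 : ‖coeff (u τ) j.1‖ ≤ ‖coeff (u τ) j.1 - coeff (u t) j.1‖ + ‖coeff (u t) j.1‖ := by
          simpa using norm_add_le (coeff (u τ) j.1 - coeff (u t) j.1) (coeff (u t) j.1)
        have h5 := pow_le_pow_left₀ (norm_nonneg _) h4 2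
        have h6 : ‖coeff (u τ) j.1‖ ^ 2 ≤ 2 * ‖coeff (u τ) j.1 - coeff (u t) j.1‖ ^ 2 +
            2 * ‖coeff (u t) j.1‖ ^ 2 := by
          nlinarith [sq_nonneg (‖coeff (u τ) j.1 - coeff (u t) j.1‖ - ‖coeff (u t) j.1‖)]
        have h7 := mul_le_mul (hcube j) h6 (sq_nonneg _)
          (Real.rpow_nonneg (freqNorm_nonneg _) _)
        linarith
      rw [Finset.sum_add_distrib, ← Finset.mul_sum, ← Finset.mul_sum] at h3
      linarith
  choose! g hg hgder using h.equation
  have hsum : ∀ t ∈ Icc 0 T, HasSum (fun j : Freq d => freqNorm j.1 ^ 2 * ‖coeff (u t) j.1‖ ^ 2)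
      (1 + integralSq (g t) - 1) := fun t ht => by
    rw [add_sub_cancel_left]; exact hasSum_integralSq (hg t ht)
  refine ⟨R, fun t => 1 + integralSq (g t), fun j t ht => ⟨?_, ?_⟩, fun t ht => ?_, hsum, hR⟩
  · rw [hasDerivWithinAt_iff_tendsto_slope, tendsto_iff_norm_sub_tendsto_zero]
    refine squeeze_zero' (Eventually.of_forall fun _ => norm_nonneg _) ?_
      (h.regular_deriv.hasDeriv t ht)
    filter_upwards [self_mem_nhdsWithin] with τ hτ
    have hs := summable_sobTerm_sub (summable_sobTerm_smul (τ - t)⁻¹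
      (summable_sobTerm_sub (h.regular_deriv.continuous.mem τ hτ.1).finite_norm
        (h.regular_deriv.continuous.mem t ht).finite_norm))
      (h.regular_deriv.deriv_continuous.mem t ht).finite_norm
    simp only [← coeff_sub, ← coeff_real_smul] at hs
    have := norm_coeff_le_sobNorm (by linarith) hs j
    simpa [coeff_sub, coeff_real_smul, slope_def_module] using this
  · refine (hgder t ht j.1).congr_deriv ?_
    rw [laplacianCoeff, Complex.real_smul]
    push_cast
    ring
  · have hlim : Tendsto (fun τ => sobNorm (m₀ d - 1 / 2) (u τ - u t) ^ 2) (𝓝[Icc 0 T] t) (𝓝 0) := by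
      simpa using (h.regular_deriv.continuous.continuous t ht).pow 2
    -- Continuity of `a` follows from continuity of `u` in the weaker norm and the uniform `H^{3/2}`
    -- bound.
    have hlim2 : Tendsto (fun τ => (integralSq (g τ) - integralSq (g t)) ^ 2) (𝓝[Icc 0 T] t)
        (𝓝 0) := by
      have hlim' : Tendsto (fun τ => 4 * R * sobNorm (m₀ d - 1 / 2) (u τ - u t) ^ 2)
          (𝓝[Icc 0 T] t) (𝓝 0) := by
        simpa using hlim.const_mul (4 * R)
      refine squeeze_zero' (Eventually.of_forall fun _ => sq_nonneg _) ?_ hlim'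
      filter_upwards [self_mem_nhdsWithin] with τ hτ
      refine sq_sub_le_of_hasSum one_le_freqNorm (hasSum_integralSq (hg τ hτ))
        (hasSum_integralSq (hg t ht)) (hR τ hτ) (hR t ht) fun J => ?_
      have hs := summable_sobTerm_sub (h.regular_deriv.continuous.mem τ hτ).finite_norm
        (h.regular_deriv.continuous.mem t ht).finite_norm
      rw [sobNorm_sq]
      simp only [coeff_sub]
      refine le_trans (Finset.sum_le_sum fun j _ => ?_)
        (hs.sum_le_tsum J fun j _ => sobTerm_nonneg _ _ _)
      rw [mul_comm]
      exact mul_le_mul_of_nonneg_left (hone j) (sq_nonneg _)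
    have hlim3 := hlim2.sqrt
    simp only [Real.sqrt_sq_eq_abs, Real.sqrt_zero] at hlim3
    have hlim4 : Tendsto (fun τ => integralSq (g τ)) (𝓝[Icc 0 T] t) (𝓝 (integralSq (g t))) :=
      tendsto_iff_norm_sub_tendsto_zero.2 hlim3
    exact hlim4.const_add 1

end Torus

/-! ### Reality of the solution and the theorem on the torus -/

section Main

variable {d : ℕ} {T : ℝ}

/-- The equation is invariant under complex conjugation of functions, which reflects frequencies.
With uniqueness, this symmetry shows that real data give real solutions. -/
theorem ModeSystem.conj_neg {R : ℝ} {a : ℝ → ℝ} {U V : Freq d → ℝ → ℂ}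
    (h : ModeSystem (fun j : Freq d => freqNorm j.1) T R a U V) :
    ModeSystem (fun j : Freq d => freqNorm j.1) T R a
      (fun j t => starRingEnd ℂ (U (negFreq d j) t))
      (fun j t => starRingEnd ℂ (V (negFreq d j) t)) := by
  refine ⟨fun j t ht => ?_, h.cont, fun t ht => ?_, fun t ht J => ?_⟩
  · have h1 := h.mode (negFreq d j) t ht
    refine ⟨h1.1.star, h1.2.star.congr_deriv ?_⟩
    rw [freqNorm_negFreq, star_smul, star_trivial]
    rfl
  · refine ((negFreq d).hasSum_iff.2 (h.hasSum t ht)).congr_fun fun j => ?_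
    simp [freqNorm_negFreq]
  · refine le_trans (le_of_eq ?_) (h.bound t ht (J.map (negFreq d).toEmbedding))
    rw [Finset.sum_map]
    exact Finset.sum_congr rfl fun j _ => by simp [freqNorm_negFreq]

theorem coeff_neg_of_freq {u : L2Torus d} (h0 : coeff u 0 = 0)
    (h : ∀ j : Freq d, coeff u (-j.1) = starRingEnd ℂ (coeff u j.1)) (j : Fin d → ℤ) :
    coeff u (-j) = starRingEnd ℂ (coeff u j) := by
  by_cases hj : j = 0
  · simp [hj, h0]
  · exact h ⟨j, hj⟩

/-- A solution in modes, with its bounds, lives on the torus. -/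
theorem exists_isSolution (hT : 0 < T) {α β : L2Torus d} (hα : MemHs (m₀ d + 1 / 2) α)
    (hβ : MemHs (m₀ d - 1 / 2) β) {η : ℝ} (hη0 : 0 < η) (hη : η ≤ 1 / 100)
    (hTη : T * η ^ 2 ≤ 1 / 1600)
    (hαβ : sobNorm (m₀ d + 1 / 2) α ^ 2 + sobNorm (m₀ d - 1 / 2) β ^ 2 ≤ η) :
    ∃ u v : ℝ → L2Torus d, IsSolution T (m₀ d) α β u v ∧
      (∀ u' v' : ℝ → L2Torus d, IsSolution T (m₀ d) α β u' v' → ∀ t ∈ Icc 0 T, u' t = u t) ∧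
      ∀ s : ℝ, MemHs (s + 1 / 2) α → MemHs (s - 1 / 2) β →
        IsC0 T (s + 1 / 2) u ∧ IsC1 T (s - 1 / 2) u v ∧
        ∀ t ∈ Icc 0 T, sobNorm (s + 1 / 2) (u t) + sobNorm (s - 1 / 2) (v t) ≤
          12 * (sobNorm (s + 1 / 2) α + sobNorm (s - 1 / 2) β) := by
  have hm := one_le_m₀ (d := d)
  have hpos : ∀ j : Freq d, 0 < freqNorm j.1 := fun j => zero_lt_one.trans_le (one_le_freqNorm j)
  have hT0 : (0 : ℝ) ∈ Icc 0 T := ⟨le_rfl, hT.le⟩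
  have hinit : ∀ J : Finset (Freq d), ∑ j ∈ J, freqNorm j.1 ^ 2 * gapWeight d (freqNorm j.1) *
      modeEnergy (freqNorm j.1) (coeff α j.1) (coeff β j.1) ≤ η := fun J => by
    refine le_trans (le_of_eq (Finset.sum_congr rfl fun j _ => ?_))
      ((sum_rpow_mul_modeEnergy_le hα hβ J).trans hαβ)
    rw [abs_of_pos (hpos j), rpow_m₀_eq]
  obtain ⟨a, U, V, hsys, hi, hw, hmode, huniq⟩ := exists_modeSystem
    (lam := fun j : Freq d => freqNorm j.1) (U₀ := fun j => coeff α j.1)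
    (V₀ := fun j => coeff β j.1) one_le_freqNorm one_le_gapWeight inv_abs_freqNorm_sub_le hη0 hη
    hT hTη hinit
  choose u hu using fun t => exists_coeff_freq_eq fun j => U j t
  choose v hv using fun t => exists_coeff_freq_eq fun j => V j t
  set e₀ : Freq d → ℝ := fun j => modeEnergy (freqNorm j.1) (coeff α j.1) (coeff β j.1) with he₀
  have he0 : ∀ j, 0 ≤ e₀ j := fun j => modeEnergy_nonneg (one_le_freqNorm j) _ _
  have hsum : Summable fun j : Freq d => freqNorm j.1 * e₀ j := by
    refine (summable_of_sum_le (fun j => ?_) hinit).of_nonneg_of_le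
      (fun j => mul_nonneg (hpos j).le (he0 j)) fun j => ?_
    · exact mul_nonneg (mul_nonneg (sq_nonneg _)
        (zero_le_one.trans (one_le_gapWeight j))) (he0 j)
    · refine mul_le_mul_of_nonneg_right ?_ (he0 j)
      have h1 := one_le_freqNorm j
      nlinarith [mul_nonneg (sq_nonneg (freqNorm j.1)) (sub_nonneg.2 (one_le_gapWeight j))]
  have hb : ∀ t ∈ Icc 0 T, ∀ j : Freq d,
      ‖U j t‖ ^ 2 ≤ 2 * Real.exp T * (freqNorm j.1 * e₀ j) ∧
      ‖V j t‖ ^ 2 ≤ 2 * Real.exp T * (freqNorm j.1 * e₀ j) := fun t ht j => by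
    have h1 := norm_sq_le_of_modeEnergy_le (one_le_freqNorm j) (hmode t ht j)
    refine ⟨h1.1.trans ?_, h1.2.trans (le_of_eq (by ring))⟩
    gcongr
    exact le_mul_of_one_le_left (he0 j) (one_le_freqNorm j)
  have hUs : ∀ t ∈ Icc 0 T, Summable fun j => ‖U j t‖ ^ 2 := fun t ht =>
    (hsum.mul_left _).of_nonneg_of_le (fun j => sq_nonneg _) fun j => (hb t ht j).1
  have hVs : ∀ t ∈ Icc 0 T, Summable fun j => ‖V j t‖ ^ 2 := fun t ht =>
    (hsum.mul_left _).of_nonneg_of_le (fun j => sq_nonneg _) fun j => (hb t ht j).2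
  have hcu : ∀ t ∈ Icc 0 T, ∀ j : Freq d, coeff (u t) j.1 = U j t := fun t ht =>
    (hu t (hUs t ht)).2
  have hcv : ∀ t ∈ Icc 0 T, ∀ j : Freq d, coeff (v t) j.1 = V j t := fun t ht =>
    (hv t (hVs t ht)).2
  have hzu : ∀ t ∈ Icc 0 T, coeff (u t) 0 = 0 := fun t ht => (hu t (hUs t ht)).1
  have hzv : ∀ t ∈ Icc 0 T, coeff (v t) 0 = 0 := fun t ht => (hv t (hVs t ht)).1
  have hdU : ∀ j : Freq d, ∀ t ∈ Icc 0 T,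
      HasDerivWithinAt (fun t => coeff (u t) j.1) (coeff (v t) j.1) (Icc 0 T) t := fun j t ht => by
    rw [hcv t ht j]
    exact (hsys.mode j t ht).1.congr (fun τ hτ => hcu τ hτ j) (hcu t ht j)
  have hdV : ∀ j : Freq d, ∀ t ∈ Icc 0 T, HasDerivWithinAt (fun t => coeff (v t) j.1)
      (-(a t * freqNorm j.1 ^ 2) • coeff (u t) j.1) (Icc 0 T) t := fun j t ht => by
    rw [hcu t ht j]
    exact (hsys.mode j t ht).2.congr (fun τ hτ => hcv τ hτ j) (hcv t ht j)
  have hUconj : ∀ t ∈ Icc 0 T, ∀ j, starRingEnd ℂ (U (negFreq d j) t) = U j t :=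
    huniq 1 a _ _ hsys.conj_neg fun j => by
      simp only [(hi _).1, (hi _).2]
      have h1 := (real_valued_iff α).1 hα.real_valued j.1
      have h2 := (real_valued_iff β).1 hβ.real_valued j.1
      exact ⟨by rw [show (negFreq d j).1 = -j.1 from rfl, h1, Complex.conj_conj],
        by rw [show (negFreq d j).1 = -j.1 from rfl, h2, Complex.conj_conj]⟩
  -- Uniqueness concerns `U` only; the symmetry of `V` follows because derivatives within `[0,T]`
  -- are unique when `T > 0`.
  have hVconj : ∀ t ∈ Icc 0 T, ∀ j, starRingEnd ℂ (V (negFreq d j) t) = V j t := fun t ht j =>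
    (uniqueDiffOn_Icc hT t ht).eq_deriv _
      ((hsys.conj_neg.mode j t ht).1.congr (fun τ hτ => (hUconj τ hτ j).symm)
        (hUconj t ht j).symm) (hsys.mode j t ht).1
  have hru : ∀ t ∈ Icc 0 T, ∀ j, coeff (u t) (-j) = starRingEnd ℂ (coeff (u t) j) := fun t ht =>
    coeff_neg_of_freq (hzu t ht) fun j => by
      rw [hcu t ht, ← hUconj t ht, Complex.conj_conj, ← hcu t ht]; rfl
  have hrv : ∀ t ∈ Icc 0 T, ∀ j, coeff (v t) (-j) = starRingEnd ℂ (coeff (v t) j) := fun t ht =>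
    coeff_neg_of_freq (hzv t ht) fun j => by
      rw [hcv t ht, ← hVconj t ht, Complex.conj_conj, ← hcv t ht]; rfl
  have hreg := fun (s : ℝ) (hαs : MemHs (s + 1 / 2) α) (hβs : MemHs (s - 1 / 2) β) =>
    regularity_of_modes hru hrv hzu hzv hdU
      (fun j t ht => (hdV j t ht).continuousWithinAt)
      (fun t ht j => by rw [hcu t ht, hcv t ht]; exact hmode t ht j)
      (fun w hw0 W hW t ht J => by
        simp only [hcu t ht, hcv t ht]
        exact hw w hw0 W hW t ht J) hαs hβs
  obtain ⟨hC0, hC1, -⟩ := hreg (m₀ d) hα hβ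
  refine ⟨u, v, ⟨hC0, hC1, ?_, ?_, fun t ht => ?_⟩, fun u' v' h' t ht => ?_, hreg⟩
  · refine coeff_ext fun j => ?_
    by_cases hj : j = 0
    · rw [hj, hzu 0 hT0, hα.zero_mean]
    · exact (hcu 0 hT0 ⟨j, hj⟩).trans (hi ⟨j, hj⟩).1
  · refine coeff_ext fun j => ?_
    by_cases hj : j = 0
    · rw [hj, hzv 0 hT0, hβ.zero_mean]
    · exact (hcv 0 hT0 ⟨j, hj⟩).trans (hi ⟨j, hj⟩).2
  · have hs : HasSum (fun j : Freq d => freqNorm j.1 ^ 2 * ‖coeff (u t) j.1‖ ^ 2) (a t - 1) := by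
      simpa only [hcu t ht] using hsys.hasSum t ht
    obtain ⟨g, hg⟩ := exists_isGradient hs.summable
    have ha : 1 + integralSq g = a t := by
      rw [(hasSum_integralSq hg).unique hs]; ring
    refine ⟨g, hg, fun j => ?_⟩
    rw [ha, laplacianCoeff]
    by_cases hj : j = 0
    · subst hj
      refine ((hasDerivWithinAt_const t (Icc 0 T) (0 : ℂ)).congr hzv (hzv t ht)).congr_deriv ?_
      simp [hzu t ht]
    · refine (hdV ⟨j, hj⟩ t ht).congr_deriv ?_
      rw [Complex.real_smul]
      push_cast
      ring
  · obtain ⟨R, a', hsys'⟩ := h'.exists_modeSystem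
    have h1 := huniq R a' _ _ hsys' (fun j => by rw [h'.initial, h'.initial_deriv]; exact ⟨rfl, rfl⟩)
      t ht
    refine coeff_ext fun j => ?_
    by_cases hj : j = 0
    · rw [hj, hzu t ht, (h'.regular.mem t ht).zero_mean]
    · exact (h1 ⟨j, hj⟩).trans (hcu t ht ⟨j, hj⟩).symm

end Main

end Kirchhoff

theorem theorem1p1 :
    ∃ ε₀ C C₁ : ℝ, 0 < ε₀ ∧ 0 < C ∧ 0 < C₁ ∧
      ∀ (d : ℕ), 1 ≤ d → ∀ α β : Kirchhoff.L2Torus d,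
        Kirchhoff.MemHs (Kirchhoff.m₀ d + 1 / 2) α →
        Kirchhoff.MemHs (Kirchhoff.m₀ d - 1 / 2) β →
        ∀ ε : ℝ,
          ε = Kirchhoff.sobNorm (Kirchhoff.m₀ d + 1 / 2) α +
            Kirchhoff.sobNorm (Kirchhoff.m₀ d - 1 / 2) β →
          ε ≤ ε₀ →
          ∀ T : ℝ, 0 < T → T * ε ^ 4 ≤ C₁ →
            ∃ u v : ℝ → Kirchhoff.L2Torus d,
              Kirchhoff.IsSolution T (Kirchhoff.m₀ d) α β u v ∧
              (∀ u' v' : ℝ → Kirchhoff.L2Torus d,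
                Kirchhoff.IsSolution T (Kirchhoff.m₀ d) α β u' v' →
                ∀ t ∈ Set.Icc 0 T, u' t = u t) ∧
              (∀ t ∈ Set.Icc 0 T,
                Kirchhoff.sobNorm (Kirchhoff.m₀ d + 1 / 2) (u t) +
                  Kirchhoff.sobNorm (Kirchhoff.m₀ d - 1 / 2) (v t) ≤ C * ε) ∧
              ∀ s : ℝ, Kirchhoff.m₀ d ≤ s →
                Kirchhoff.MemHs (s + 1 / 2) α → Kirchhoff.MemHs (s - 1 / 2) β →
                Kirchhoff.IsC0 T (s + 1 / 2) u ∧ Kirchhoff.IsC1 T (s - 1 / 2) u v ∧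
                ∀ t ∈ Set.Icc 0 T,
                  Kirchhoff.sobNorm (s + 1 / 2) (u t) + Kirchhoff.sobNorm (s - 1 / 2) (v t) ≤
                    C * (Kirchhoff.sobNorm (s + 1 / 2) α + Kirchhoff.sobNorm (s - 1 / 2) β) := by
  -- With `η = ε²`, the conditions `η ≤ 1/100` and `T η² ≤ 1/1600` become `ε ≤ 1/10` and `T ε⁴ ≤
  -- 1/1600`.
  refine ⟨1 / 10, 12, 1 / 1600, by norm_num, by norm_num, by norm_num, ?_⟩
  intro d _ α β hα hβ ε hε hε₀ T hT hTε
  have hα0 := Kirchhoff.sobNorm_nonneg (Kirchhoff.m₀ d + 1 / 2) α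
  have hβ0 := Kirchhoff.sobNorm_nonneg (Kirchhoff.m₀ d - 1 / 2) β
  have hε0 : 0 ≤ ε := by rw [hε]; exact add_nonneg hα0 hβ0
  obtain ⟨η, hη0, hη, hTη, hεη⟩ :
      ∃ η : ℝ, 0 < η ∧ η ≤ 1 / 100 ∧ T * η ^ 2 ≤ 1 / 1600 ∧ ε ^ 2 ≤ η := by
    rcases hε0.eq_or_lt with h | h
    -- For zero data `η` must still be positive, so it is taken small in terms of `T`.
    · have h1 : 0 < 1 / (1600 * (T + 1)) := by positivity
      have h2 : 1 / (1600 * (T + 1)) ≤ 1 / 100 :=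
        one_div_le_one_div_of_le (by norm_num) (by linarith)
      refine ⟨_, h1, h2, ?_, by rw [← h]; simpa using h1.le⟩
      have h3 : T * (1 / (1600 * (T + 1))) ≤ 1 / 1600 := by
        rw [mul_one_div, div_le_div_iff₀ (by positivity) (by norm_num)]
        linarith
      nlinarith
    · exact ⟨ε ^ 2, by positivity, by nlinarith, by linarith [hTε, pow_mul ε 2 2], le_rfl⟩
  obtain ⟨u, v, hsol, huniq, hreg⟩ := Kirchhoff.exists_isSolution hT hα hβ hη0 hη hTη
    (le_trans (by rw [hε]; nlinarith) hεη)
  refine ⟨u, v, hsol, huniq, fun t ht => ?_, fun s _ hαs hβs => hreg s hαs hβs⟩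
  rw [hε]
  exact (hreg _ hα hβ).2.2 t ht
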